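/- **Theorem 1 (noiseless signals).** For a vector $v$ write $|v|$ for the vector of the absolute values of its coordinates, and call $x\in\mathbb{C}^n$ $k$-sparse if at most $k$ of its coordinates are non-zero. For every $c>0$ there are a constant $C>0$ and a deterministic decoding procedure (one program, depending only on $c$) such that for all natural numbers $n$ and $k\ge 2$ there are a number of measurements $m\le Ck$ and a probability distribution on matrices $\Phi\in\mathbb{C}^{m\times n}$ with the following properties. 1. For every matrix $\Phi\in\mathbb{C}^{m\times n}$ and every $y\in\mathbb{R}^m$ the procedure, run on $(\Phi,y)$, halts after at most $C\,k\log k$ steps; denote its output by $\mathcal{R}(\Phi,y)\in\mathbb{C}^n$. 2. For every $k$-sparse $x\in\mathbb{C}^n$, with probability at least $1-k^{-c}$ over the choice of $\Phi$, the output $\hat x=\mathcal{R}(\Phi,|\Phi x|)$ satisfies $\hat x=e^{i\theta}x$ for some $\theta\in[0,2\pi)$. Running time is counted on a real RAM: a random access machine with integer cells holding words of $O(\log(n+m+k))$ bits and real cells, where each of the following takes one step: $+,-,\times,\div$ on words or on reals, comparisons, jumps, direct and indirect addressing, conversion of a word to a real and rounding down of a real to a word (if it fits), reading a coordinate of $y$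 or the real or imaginary part of an entry of $\Phi$, and appending a pair (coordinate, value) to the output, which is a sparse representation of $\hat x$. The matrix is also stored by the lists of the positions of the non-zero entries of its columns, with random access to each list and its length. The machine is given $n$, $m$ and $k$. -/

import Mathlib

/-!
Compressive phase retrieval: sparse signals, phaseless measurements, and a real RAM
(a word RAM with additional real-valued memory) with unit-cost steps on which decoding
procedures are run.
-/

open MeasureTheory

namespace PhaseRetrieval

/-- The Borel σ-algebra on complex matrices, entry by entry. -/
noncomputable instance instMeasurableSpaceMatrix {m n : ℕ} : MeasurableSpace (Matrix (Fin m) (Fin n) ℂ) :=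
  inferInstanceAs (MeasurableSpace (Fin m → Fin n → ℂ))

/-- A signal is `k`-sparse if it has at most `k` non-zero coordinates. -/
def IsSparse {n : ℕ} (k : ℕ) (x : Fin n → ℂ) : Prop :=
  {j : Fin n | x j ≠ 0}.ncard ≤ k

/-- The phaseless measurements `|Φ x|` (coordinatewise absolute values). -/
noncomputable def phaseless {m n : ℕ} (Φ : Matrix (Fin m) (Fin n) ℂ) (x : Fin n → ℂ) :
    Fin m → ℝ :=
  fun i => ‖Φ.mulVec x i‖

/-- The instructions of the machine. All arguments except the value `v` of `iconst` and the
jump targets `l` are addresses of memory cells: of integer cells (prefix `I`) or of real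
cells (prefix `R`). -/
inductive Instr : Type
  /-- `I[d] := v` -/
  | iconst (d v : ℕ)
  /-- `I[d] := I[a] + I[b]` -/
  | iadd (d a b : ℕ)
  /-- `I[d] := I[a] - I[b]`, truncated at zero -/
  | isub (d a b : ℕ)
  /-- `I[d] := I[a] * I[b]` -/
  | imul (d a b : ℕ)
  /-- `I[d] := I[a] / I[b]`, rounded down -/
  | idiv (d a b : ℕ)
  /-- `I[d] := I[I[a]]` -/
  | iload (d a : ℕ)
  /-- `I[I[d]] := I[a]` -/
  | istore (d a : ℕ)
  /-- `R[d] := R[a] + R[b]` -/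
  | radd (d a b : ℕ)
  /-- `R[d] := R[a] - R[b]` -/
  | rsub (d a b : ℕ)
  /-- `R[d] := R[a] * R[b]` -/
  | rmul (d a b : ℕ)
  /-- `R[d] := R[a] / R[b]` -/
  | rdiv (d a b : ℕ)
  /-- `R[d] := R[I[a]]` -/
  | rload (d a : ℕ)
  /-- `R[I[d]] := R[a]` -/
  | rstore (d a : ℕ)
  /-- `R[d] := I[a]` -/
  | toReal (d a : ℕ)
  /-- `I[d] := ⌊R[a]⌋` if this is a natural number that fits in a word, and `0` otherwise -/
  | floor (d a : ℕ)
  /-- go to instruction `l` -/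
  | jump (l : ℕ)
  /-- go to instruction `l` if `I[a] < I[b]` -/
  | jumpIlt (a b l : ℕ)
  /-- go to instruction `l` if `R[a] < R[b]` -/
  | jumpRlt (a b l : ℕ)
  /-- `R[d] :=` the measurement with index `I[i]` -/
  | measurement (d i : ℕ)
  /-- `R[d] :=` the real part of the entry of the matrix in row `I[i]` and column `I[j]` -/
  | entryRe (d i j : ℕ)
  /-- `R[d] :=` the imaginary part of the entry of the matrix in row `I[i]`, column `I[j]` -/
  | entryIm (d i j : ℕ)
  /-- `I[d] :=` the number of non-zero entries in column `I[j]` -/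
  | colLength (d j : ℕ)
  /-- `I[d] :=` the row index of the non-zero entry number `I[t]` (counted from zero, from top
  to bottom) in column `I[j]` -/
  | colRow (d j t : ℕ)
  /-- append to the output that coordinate `I[i]` has the value `R[a] + R[b] * i` -/
  | emit (i a b : ℕ)

/-- A decoding procedure: a finite program, and a constant that determines the word length:
on an input with parameters `n`, `m`, `k`, the words are the natural numbers below
`(n + m + k + 2) ^ wordExp`, so that a word has `O(log (n + m + k))` bits. -/
structure Decoder : Type where
  code : List Instr
  wordExp : ℕ

/-- A configuration of the machine: program counter, integer memory, real memory, and the list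
of the pairs (coordinate, value) that were output so far. -/
structure Config : Type where
  pc : ℕ
  ints : ℕ → ℕ
  reals : ℕ → ℝ
  out : List (ℕ × ℂ)

/-- Number of words: integer arithmetic is modulo this number. -/
def Decoder.wordBound (P : Decoder) (n m k : ℕ) : ℕ := (n + m + k + 2) ^ P.wordExp

/-- Proceed to the next instruction. -/
def Config.next (s : Config) : Config := { s with pc := s.pc + 1 }

/-- Write a value (reduced to a word) to an integer cell and proceed. -/
def Config.setInt (s : Config) (W d v : ℕ) : Config :=
  { s with pc := s.pc + 1, ints := Function.update s.ints d (v % W) }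

/-- Write a value to a real cell and proceed. -/
noncomputable def Config.setReal (s : Config) (d : ℕ) (v : ℝ) : Config :=
  { s with pc := s.pc + 1, reals := Function.update s.reals d v }

/-- The entry of a matrix at given row and column numbers, `0` outside the matrix. -/
def entryAt {m n : ℕ} (Φ : Matrix (Fin m) (Fin n) ℂ) (i j : ℕ) : ℂ :=
  if h : i < m ∧ j < n then Φ ⟨i, h.1⟩ ⟨j, h.2⟩ else 0

/-- The coordinate of a vector at a given number, `0` outside the vector. -/
def coordAt {m : ℕ} (y : Fin m → ℝ) (i : ℕ) : ℝ :=
  if h : i < m then y ⟨i, h⟩ else 0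

open scoped Classical in
/-- The increasing list of the row indices of the non-zero entries in column `j`. -/
noncomputable def colList {m n : ℕ} (Φ : Matrix (Fin m) (Fin n) ℂ) (j : ℕ) : List ℕ :=
  (List.range m).filter fun i => entryAt Φ i j ≠ 0

open scoped Classical in
/-- The effect of one instruction, for the matrix `Φ`, the measurements `y` and the number `W`
of words. -/
noncomputable def Instr.exec {m n : ℕ} (W : ℕ) (Φ : Matrix (Fin m) (Fin n) ℂ) (y : Fin m → ℝ)
    (s : Config) : Instr → Config
  | .iconst d v => s.setInt W d v
  | .iadd d a b => s.setInt W d (s.ints a + s.ints b)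
  | .isub d a b => s.setInt W d (s.ints a - s.ints b)
  | .imul d a b => s.setInt W d (s.ints a * s.ints b)
  | .idiv d a b => s.setInt W d (s.ints a / s.ints b)
  | .iload d a => s.setInt W d (s.ints (s.ints a))
  | .istore d a => s.setInt W (s.ints d) (s.ints a)
  | .radd d a b => s.setReal d (s.reals a + s.reals b)
  | .rsub d a b => s.setReal d (s.reals a - s.reals b)
  | .rmul d a b => s.setReal d (s.reals a * s.reals b)
  | .rdiv d a b => s.setReal d (s.reals a / s.reals b)
  | .rload d a => s.setReal d (s.reals (s.ints a))
  | .rstore d a => s.setReal (s.ints d) (s.reals a)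
  | .toReal d a => s.setReal d (s.ints a : ℝ)
  | .floor d a => s.setInt W d (if ⌊s.reals a⌋₊ < W then ⌊s.reals a⌋₊ else 0)
  | .jump l => { s with pc := l }
  | .jumpIlt a b l => if s.ints a < s.ints b then { s with pc := l } else s.next
  | .jumpRlt a b l => if s.reals a < s.reals b then { s with pc := l } else s.next
  | .measurement d i => s.setReal d (coordAt y (s.ints i))
  | .entryRe d i j => s.setReal d (entryAt Φ (s.ints i) (s.ints j)).re
  | .entryIm d i j => s.setReal d (entryAt Φ (s.ints i) (s.ints j)).im
  | .colLength d j => s.setInt W d (colList Φ (s.ints j)).length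
  | .colRow d j t => s.setInt W d ((colList Φ (s.ints j)).getD (s.ints t) 0)
  | .emit i a b => { s.next with out := s.out ++ [(s.ints i, ⟨s.reals a, s.reals b⟩)] }

/-- The machine has halted when the program counter has left the program. -/
def Decoder.Halted (P : Decoder) (s : Config) : Prop := P.code.length ≤ s.pc

/-- One step of the machine; a halted configuration does not change. -/
noncomputable def Decoder.step (P : Decoder) (k : ℕ) {m n : ℕ} (Φ : Matrix (Fin m) (Fin n) ℂ)
    (y : Fin m → ℝ) (s : Config) : Config :=
  match P.code[s.pc]? with
  | none => s
  | some c => c.exec (P.wordBound n m k) Φ y s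

/-- The initial configuration: the first three integer cells hold `n`, `m` and `k`, all other
cells are zero. -/
def Decoder.init (P : Decoder) (n m k : ℕ) : Config where
  pc := 0
  ints := fun a =>
    (if a = 0 then n else if a = 1 then m else if a = 2 then k else 0) % P.wordBound n m k
  reals := fun _ => 0
  out := []

/-- The configuration after `t` steps. -/
noncomputable def Decoder.run (P : Decoder) (k : ℕ) {m n : ℕ} (Φ : Matrix (Fin m) (Fin n) ℂ)
    (y : Fin m → ℝ) (t : ℕ) : Config :=
  (P.step k Φ y)^[t] (P.init n m k)

/-- The vector in `ℂⁿ` given by a list of pairs (coordinate, value). -/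
noncomputable def toVector (n : ℕ) (l : List (ℕ × ℂ)) : Fin n → ℂ :=
  fun j => (l.map fun p => if p.1 = (j : ℕ) then p.2 else 0).sum

/-- On sparsity parameter `k`, matrix `Φ` and measurements `y`, the procedure `P` halts within
`T` steps and outputs the vector `z` (in sparse representation). -/
def Decoder.OutputsWithin (P : Decoder) (k : ℕ) {m n : ℕ} (Φ : Matrix (Fin m) (Fin n) ℂ)
    (y : Fin m → ℝ) (T : ℝ) (z : Fin n → ℂ) : Prop :=
  ∃ t : ℕ, (t : ℝ) ≤ T ∧ P.Halted (P.run k Φ y t) ∧ toVector n (P.run k Φ y t).out = z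

end PhaseRetrieval

/-!
The measurements are chosen so that phase retrieval becomes a linear problem. One row measures the
absolute value of a generic reference value `u = ∑ a ^ j * x j`. For every linear functional `v` of
`x` that is needed, `|v|` and `|v + u|` are measured as well, which by polarization determines the
real part of `2 * conj u * v`; where the imaginary part is needed too, so is `|v + I * u|`
(`norm_add_sq_sub`, `norm_add_I_mul_sq_sub`). So the decoder has linear measurements of
`Z = 2 * conj u * x`, and `Z / (2 * |u|)` is `x` up to a phase
(`encodes_sensingMatrix`, `exists_phase_of_separates`).

The vector `Z` is recovered by peeling. An even number `d` of hash functions, depending only on `c`,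
send the coordinates to `8 * k` cells each, and for every cell the sum of its coordinates and the
sum of their real parts with the weights `g j = j + t ^ (j + 1)` are known. If a cell has exactly
one coordinate `j` of the support left, then the quotient of the two sums is `g j`, whose integer
part is `j`. For generic `a` and `t` no other cell passes this test (`Separates`). A coordinate that
has been found is removed from its `d` cells, and these are queued for another inspection
(`PeelState.pass_succ`). Each coordinate is found once, so `9 * d * k` inspections of constant cost
suffice (`run_timeBound`), and the running time is even `O(k)`. The program never writes to an
integer cell with a computed address; therefore its counters are safe, and it halts in time,
whatever the matrix and the measurements are.

Peeling stops early only at a stopping set: a non-empty subset `U` of the support without a cell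
that contains exactly one member of `U`. Then each hash function takes at most `|U| / 2` values on
`U`, and a union bound over `U` shows that this happens with probability at most `k ^ (-D)` where
`d = 2 * (D + 1)` (`card_stuck_le`). The parameters `a` and `t` are drawn from `N` values each; the
bad values are among the roots of a number of polynomials that is bounded in terms of `n`, and `N`
is taken so large that they do not matter (`card_reference_degenerate_le`,
`card_weight_degenerate_le`). Since the machine computes with exact real numbers, the size of `N`
costs nothing.
-/

namespace PhaseRetrieval

/-! ### Executing straight-line code and loops -/

/-- The instructions after which control passes to the next instruction. -/
def Instr.Straight : Instr → Prop
  | .jump _ => False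
  | .jumpIlt _ _ _ => False
  | .jumpRlt _ _ _ => False
  | _ => True

/-- The effect of a list of instructions executed one after the other. -/
noncomputable def execList {m n : ℕ} (W : ℕ) (Φ : Matrix (Fin m) (Fin n) ℂ) (y : Fin m → ℝ)
    (l : List Instr) (s : Config) : Config :=
  l.foldl (fun s c => c.exec W Φ y s) s

section Machine

variable {m n : ℕ} {W : ℕ} {Φ : Matrix (Fin m) (Fin n) ℂ} {y : Fin m → ℝ}

@[simp] theorem execList_nil (s : Config) : execList W Φ y [] s = s := rfl

@[simp] theorem execList_cons (c : Instr) (l : List Instr) (s : Config) :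
    execList W Φ y (c :: l) s = execList W Φ y l (c.exec W Φ y s) := rfl

theorem execList_append (l l' : List Instr) (s : Config) :
    execList W Φ y (l ++ l') s = execList W Φ y l' (execList W Φ y l s) := by
  simp [execList]

theorem Instr.Straight.exec_pc {c : Instr} (hc : c.Straight) (s : Config) :
    (c.exec W Φ y s).pc = s.pc + 1 := by
  cases c <;> first | rfl | exact hc.elim

theorem execList_pc {l : List Instr} (hl : ∀ c ∈ l, c.Straight) (s : Config) :
    (execList W Φ y l s).pc = s.pc + l.length := by
  induction l generalizing s with
  | nil => rfl
  | cons c l ih =>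
    rw [execList_cons, ih (fun c' hc' => hl c' (List.mem_cons_of_mem _ hc')),
      (hl c List.mem_cons_self).exec_pc, List.length_cons]
    omega

theorem Decoder.step_of_getElem? {P : Decoder} {k : ℕ} {s : Config} {c : Instr}
    (h : P.code[s.pc]? = some c) :
    P.step k Φ y s = c.exec (P.wordBound n m k) Φ y s := by
  simp [Decoder.step, h]

theorem Decoder.iterate_step_straight {P : Decoder} {k : ℕ} {pre l post : List Instr}
    (hP : P.code = pre ++ l ++ post) (hl : ∀ c ∈ l, c.Straight) {s : Config}
    (hs : s.pc = pre.length) :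
    (P.step k Φ y)^[l.length] s = execList (P.wordBound n m k) Φ y l s := by
  induction l generalizing pre s with
  | nil => rfl
  | cons c l ih =>
    have hc : P.code[s.pc]? = some c := by simp [hP, hs]
    rw [List.length_cons, Function.iterate_succ_apply, step_of_getElem? hc, execList_cons]
    refine ih (pre := pre ++ [c]) (by simp [hP])
      (fun c' hc' => hl c' (List.mem_cons_of_mem _ hc')) ?_
    simp [(hl c List.mem_cons_self).exec_pc, hs]

theorem Decoder.step_of_halted {P : Decoder} {k : ℕ} {s : Config} (h : P.Halted s) :
    P.step k Φ y s = s := by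
  simp [Decoder.step, List.getElem?_eq_none h]

theorem Decoder.iterate_step_of_halted {P : Decoder} {k : ℕ} {s : Config} (h : P.Halted s)
    (t : ℕ) : (P.step k Φ y)^[t] s = s :=
  Function.iterate_fixed (step_of_halted h) t

end Machine

/-- The loop rule: if each of `N` passes takes at most `L` steps and preserves the invariant, then
the invariant holds after at most `L * N` steps. -/
theorem exists_iterate_of_invariant {α : Type*} {f : α → α} {N L : ℕ} (Inv : ℕ → α → Prop)
    (hstep : ∀ i < N, ∀ s, Inv i s → ∃ t ≤ L, Inv (i + 1) (f^[t] s)) {s : α} (h0 : Inv 0 s) :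
    ∃ t ≤ L * N, Inv N (f^[t] s) := by
  induction N with
  | zero => exact ⟨0, by simp, h0⟩
  | succ N ih =>
    obtain ⟨t, ht, hI⟩ := ih fun i hi => hstep i (by omega)
    obtain ⟨t', ht', hI'⟩ := hstep N (by omega) _ hI
    refine ⟨t' + t, by rw [Nat.mul_succ]; omega, ?_⟩
    rwa [Function.iterate_add_apply]

/-! ### The decoding program -/

/-- Address of the first record: the real cells below it serve as registers, and the rows of the
sensing matrix below it hold the data from which the program reads its hash functions. -/
def base (d : ℕ) : ℕ := d + 32

/-- Constants: `I[4] = 5` (the record length), `I[11] = 1`, `I[13] = base d`; counter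
`I[5] = base d`; end of the work list `I[6] = m + 5 * d * k`; its write position `I[7] = m`. -/
def setup (d : ℕ) : List Instr :=
  [.iconst 4 5, .iconst 11 1, .iconst 13 (base d), .iconst 6 (5 * d), .imul 6 6 2, .iadd 6 1 6,
    .iadd 7 1 3, .iadd 5 13 3]

/-- The head of the loop, at position 8. It leaves the program once the counter reaches the end
of the work list; otherwise it puts into `I[8]` the record of the cell to be inspected: the
counter itself while this is below `m`, an entry of the work list afterwards. -/
def fetch (d : ℕ) : List Instr :=
  [.jumpIlt 5 6 10, .jump (100 + 100 * d), .jumpIlt 5 1 15, .rload 1 5, .floor 8 1,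
    .iadd 8 13 8, .jump 16, .iadd 8 5 3]

/-- Computes the residual cell sums `R[4]`, `R[5]`, `R[7]` (real part, imaginary part, weighted
real part) of the cell with record `I[8]`, the ratio `R[14]`, the candidate coordinate `I[10]`,
and in `R[15]` the square of the difference of the ratio and the weight of the candidate. -/
def inspect : List Instr :=
  [.iadd 5 5 4, .measurement 2 3, .measurement 3 8, .rload 10 8,
    .iadd 9 8 11, .measurement 4 9, .rload 11 9,
    .iadd 9 9 11, .measurement 5 9, .rload 12 9,
    .iadd 9 9 11, .measurement 6 9,
    .iadd 9 9 11, .measurement 7 9,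
    .rmul 13 2 2, .rmul 3 3 3, .rmul 4 4 4, .rmul 5 5 5, .rmul 6 6 6, .rmul 7 7 7,
    .radd 3 3 13, .rsub 4 4 3, .rsub 4 4 10, .rsub 5 5 3, .rsub 5 5 11,
    .radd 6 6 13, .rsub 7 7 6, .rsub 7 7 12,
    .rdiv 14 7 4, .floor 10 14, .entryRe 15 11 10, .rsub 15 15 14, .rmul 15 15 15]

/-- Outputs the candidate coordinate with its normalized value. -/
def emitCandidate : List Instr :=
  [.radd 2 2 2, .rdiv 16 4 2, .rdiv 17 5 2, .emit 10 16 17]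

/-- Appends the cell of the candidate in table `l` to the work list, and adds the candidate to
what has been recovered from this cell. -/
def removeFromTable (l : ℕ) : List Instr :=
  [.iconst 12 (2 + l), .entryRe 18 12 10, .rstore 7 18, .iadd 7 7 4, .floor 14 18,
    .iadd 14 13 14, .rload 19 14, .radd 19 19 4, .rstore 14 19,
    .iadd 14 14 11, .rload 19 14, .radd 19 19 5, .rstore 14 19,
    .iadd 14 14 11, .rload 19 14, .radd 19 19 7, .rstore 14 19]

/-- `removeFromTable` for all of the `d` tables. -/
def removeFromTables : ℕ → List Instr
  | 0 => []
  | d + 1 => removeFromTables d ++ removeFromTable d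

/-- The peeling decoder with `d` hash tables. -/
def peeler (d : ℕ) : Decoder where
  code := setup d ++ fetch d ++ inspect ++ [.jumpRlt 0 15 8] ++
    (emitCandidate ++ removeFromTables d) ++ [.jump 8]
  wordExp := 2

theorem length_removeFromTables (d : ℕ) : (removeFromTables d).length = 17 * d := by
  induction d with
  | zero => rfl
  | succ d ih => simp [removeFromTables, ih, removeFromTable]; omega

theorem length_code_peeler (d : ℕ) : (peeler d).code.length = 55 + 17 * d := by
  simp [peeler, setup, fetch, inspect, emitCandidate, length_removeFromTables]; omega

theorem straight_removeFromTable (l : ℕ) : ∀ c ∈ removeFromTable l, c.Straight := by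
  simp [removeFromTable, Instr.Straight]

theorem straight_removeFromTables (d : ℕ) : ∀ c ∈ removeFromTables d, c.Straight := by
  induction d with
  | zero => simp [removeFromTables]
  | succ d ih =>
    intro c hc
    rcases List.mem_append.1 hc with hc | hc
    · exact ih c hc
    · exact straight_removeFromTable d c hc

section Program

variable {m n : ℕ} {W : ℕ} {Φ : Matrix (Fin m) (Fin n) ℂ} {y : Fin m → ℝ}

open scoped Classical in
/-- The configuration in which the loop body starts to inspect a cell. -/
noncomputable def fetched {m n : ℕ} (W : ℕ) (Φ : Matrix (Fin m) (Fin n) ℂ) (y : Fin m → ℝ)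
    (s : Config) : Config :=
  if s.ints 5 < s.ints 1 then { execList W Φ y [.iadd 8 5 3] s with pc := 16 }
  else { execList W Φ y [.rload 1 5, .floor 8 1, .iadd 8 13 8] s with pc := 16 }

open scoped Classical in
/-- One pass through the loop, from its head to its head. -/
noncomputable def pass {m n : ℕ} (d W : ℕ) (Φ : Matrix (Fin m) (Fin n) ℂ) (y : Fin m → ℝ)
    (s : Config) : Config :=
  let s' := execList W Φ y inspect (fetched W Φ y s)
  if s'.reals 0 < s'.reals 15 then { s' with pc := 8 }
  else { execList W Φ y (emitCandidate ++ removeFromTables d) s' with pc := 8 }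

theorem iterate_step_fetched {d k : ℕ} {s : Config} (hpc : s.pc = 8)
    (hlt : s.ints 5 < s.ints 6) :
    ∃ t ≤ 6, ((peeler d).step k Φ y)^[t] s = fetched ((peeler d).wordBound n m k) Φ y s := by
  set W := (peeler d).wordBound n m k with hW
  have h0 : (peeler d).step k Φ y s = { s with pc := 10 } := by
    rw [Decoder.step_of_getElem? (c := .jumpIlt 5 6 10) (by rw [hpc]; rfl)]
    simp [Instr.exec, hlt]
  by_cases h : s.ints 5 < s.ints 1
  · refine ⟨3, by norm_num, ?_⟩
    have h1 : (peeler d).step k Φ y { s with pc := 10 } = { s with pc := 15 } := by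
      rw [Decoder.step_of_getElem? (c := .jumpIlt 5 1 15) rfl]
      simp [Instr.exec, h]
    simp only [Function.iterate_succ_apply, Function.iterate_zero_apply, h0, h1]
    rw [Decoder.step_of_getElem? (c := .iadd 8 5 3) rfl]
    simp [fetched, h, Instr.exec, Config.setInt, hW]
  · refine ⟨6, by norm_num, ?_⟩
    have h1 : (peeler d).step k Φ y { s with pc := 10 } = { s with pc := 11 } := by
      rw [Decoder.step_of_getElem? (c := .jumpIlt 5 1 15) rfl]
      simp [Instr.exec, h, Config.next]
    simp only [Function.iterate_succ_apply, Function.iterate_zero_apply, h0, h1]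
    have h2 := Decoder.iterate_step_straight (P := peeler d) (k := k) (Φ := Φ) (y := y)
      (pre := setup d ++ (fetch d).take 3) (l := [.rload 1 5, .floor 8 1, .iadd 8 13 8])
      (post := [.jump 16, .iadd 8 5 3] ++ inspect ++ [.jumpRlt 0 15 8] ++
        (emitCandidate ++ removeFromTables d) ++ [.jump 8])
      (by simp [peeler, fetch]) (by simp [Instr.Straight]) (s := { s with pc := 11 }) rfl
    simp only [List.length_cons, List.length_nil, Function.iterate_succ_apply,
      Function.iterate_zero_apply] at h2
    rw [h2, Decoder.step_of_getElem? (c := .jump 16) rfl]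
    simp [fetched, h, Instr.exec, Config.setInt, Config.setReal, hW]

theorem iterate_step_pass {d k : ℕ} {s : Config} (hpc : s.pc = 8)
    (hlt : s.ints 5 < s.ints 6) :
    ∃ t ≤ 50 + 17 * d,
      ((peeler d).step k Φ y)^[t] s = pass d ((peeler d).wordBound n m k) Φ y s := by
  obtain ⟨t, ht, h⟩ := iterate_step_fetched (Φ := Φ) (y := y) (d := d) (k := k) hpc hlt
  have hpc1 : (fetched ((peeler d).wordBound n m k) Φ y s).pc = 16 := by
    unfold fetched; split_ifs <;> rfl
  have hst : ∀ c ∈ inspect, c.Straight := by simp [inspect, Instr.Straight]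
  have h1 := Decoder.iterate_step_straight (P := peeler d) (k := k) (Φ := Φ) (y := y)
    (pre := setup d ++ fetch d) (l := inspect)
    (post := [.jumpRlt 0 15 8] ++ (emitCandidate ++ removeFromTables d) ++ [.jump 8])
    (by simp [peeler]) hst (s := fetched ((peeler d).wordBound n m k) Φ y s)
    (by rw [hpc1]; rfl)
  set W := (peeler d).wordBound n m k
  have hpc2 := execList_pc (W := W) (Φ := Φ) (y := y) hst (fetched W Φ y s)
  set s' := execList W Φ y inspect (fetched W Φ y s) with hs'
  replace hpc2 : s'.pc = 49 := by rw [hpc2, hpc1]; rfl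
  have h2 : (peeler d).step k Φ y s' =
      if s'.reals 0 < s'.reals 15 then { s' with pc := 8 } else s'.next := by
    rw [Decoder.step_of_getElem? (c := .jumpRlt 0 15 8) (by rw [hpc2]; rfl)]
    rfl
  by_cases hlt' : s'.reals 0 < s'.reals 15
  · refine ⟨1 + inspect.length + t, by simp [inspect]; omega, ?_⟩
    rw [Function.iterate_add_apply, Function.iterate_add_apply, h, h1, Function.iterate_one, h2]
    simp [pass, ← hs', hlt']
  · have hst3 : ∀ c ∈ emitCandidate ++ removeFromTables d, c.Straight := by
      intro c hc
      rcases List.mem_append.1 hc with hc | hc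
      · have : ∀ c ∈ emitCandidate, c.Straight := by simp [emitCandidate, Instr.Straight]
        exact this c hc
      · exact straight_removeFromTables d c hc
    have h3 := Decoder.iterate_step_straight (P := peeler d) (k := k) (Φ := Φ) (y := y)
      (pre := setup d ++ fetch d ++ inspect ++ [.jumpRlt 0 15 8])
      (l := emitCandidate ++ removeFromTables d) (post := [.jump 8])
      (by simp [peeler]) hst3 (s := s'.next) (by simp [Config.next, hpc2]; rfl)
    have hpc3 := execList_pc (W := W) (Φ := Φ) (y := y) hst3 s'.next
    have hcomm : ∀ (l : List Instr), (∀ c ∈ l, c.Straight) → ∀ (s : Config) (p q : ℕ),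
        { execList W Φ y l { s with pc := p } with pc := q } =
          { execList W Φ y l s with pc := q } := by
      intro l
      induction l with
      | nil => intros; rfl
      | cons c l ih =>
        intro hl s p q
        have hc := hl c List.mem_cons_self
        have hl' := fun c' hc' => hl c' (List.mem_cons_of_mem c hc')
        have e : c.exec W Φ y { s with pc := p } =
            { c.exec W Φ y s with pc := p + 1 } := by
          cases c <;> first | rfl | exact hc.elim
        rw [execList_cons, execList_cons, e, ih hl']
    refine ⟨1 + (emitCandidate ++ removeFromTables d).length + (1 + inspect.length + t), ?_, ?_⟩
    · simp [inspect, emitCandidate, length_removeFromTables]; omega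
    rw [Function.iterate_add_apply, Function.iterate_add_apply _ (1 + inspect.length),
      Function.iterate_add_apply _ 1 inspect.length, h, h1, Function.iterate_one, h2, if_neg hlt',
      Function.iterate_add_apply, h3, Function.iterate_one,
      Decoder.step_of_getElem? (c := .jump 8)]
    · simp only [pass, ← hs', if_neg hlt']
      exact hcomm _ hst3 s' _ 8
    · rw [hpc3]
      have : s'.next.pc + (emitCandidate ++ removeFromTables d).length = 54 + 17 * d := by
        simp [Config.next, hpc2, emitCandidate, length_removeFromTables]; omega
      rw [this]
      have hl := length_code_peeler d
      simp only [peeler] at hl ⊢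
      rw [List.getElem?_append_right]
      · simp only [List.length_append, List.length_cons, List.length_nil] at hl ⊢
        have : 54 + 17 * d - ((setup d).length + (fetch d).length + inspect.length + 1 +
          (emitCandidate.length + (removeFromTables d).length)) = 0 := by omega
        simp at this ⊢
        rw [this]; rfl
      · simp only [List.length_append, List.length_cons, List.length_nil] at hl ⊢; omega

end Program

/-! ### The effect of one pass through the loop -/

section Effect

variable {m n : ℕ} {W : ℕ} {Φ : Matrix (Fin m) (Fin n) ℂ} {y : Fin m → ℝ}

theorem fetched_ints (s : Config) {r : ℕ} (h8 : r ≠ 8) :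
    (fetched W Φ y s).ints r = s.ints r := by
  unfold fetched
  split_ifs <;> simp [Instr.exec, Config.setInt, Config.setReal, h8]

theorem fetched_reals (s : Config) {r : ℕ} (h1 : r ≠ 1) :
    (fetched W Φ y s).reals r = s.reals r := by
  unfold fetched
  split_ifs <;> simp [Instr.exec, Config.setInt, Config.setReal, h1]

theorem fetched_out (s : Config) : (fetched W Φ y s).out = s.out := by
  unfold fetched
  split_ifs <;> rfl

theorem fetched_ints_eight_of_lt {s : Config} (h : s.ints 5 < s.ints 1) (h3 : s.ints 3 = 0)
    (hW : s.ints 5 < W) : (fetched W Φ y s).ints 8 = s.ints 5 := by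
  simp [fetched, h, Instr.exec, Config.setInt, h3, Nat.mod_eq_of_lt hW]

theorem fetched_ints_eight_of_le {s : Config} (h : s.ints 1 ≤ s.ints 5) {a : ℕ}
    (ha : s.reals (s.ints 5) = a) (hW : s.ints 13 + a < W) :
    (fetched W Φ y s).ints 8 = s.ints 13 + a := by
  have ha' : a < W := by omega
  simp [fetched, h.not_gt, Instr.exec, Config.setInt, Config.setReal, ha, ha', Nat.mod_eq_of_lt ha',
    Nat.mod_eq_of_lt hW]

theorem inspect_ints (s : Config) {r : ℕ} (h5 : r ≠ 5) (h9 : r ≠ 9) (h10 : r ≠ 10) :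
    (execList W Φ y inspect s).ints r = s.ints r := by
  simp [inspect, Instr.exec, Config.setInt, Config.setReal, h5, h9, h10]

theorem inspect_ints_five (s : Config) :
    (execList W Φ y inspect s).ints 5 = (s.ints 5 + s.ints 4) % W := by
  simp [inspect, Instr.exec, Config.setInt, Config.setReal]

theorem inspect_out (s : Config) : (execList W Φ y inspect s).out = s.out := rfl

theorem inspect_reals (s : Config) {r : ℕ} (hr : r < 2 ∨ 32 ≤ r) :
    (execList W Φ y inspect s).reals r = s.reals r := by
  have h : ∀ i ∈ Finset.Icc 2 31, r ≠ i := by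
    intro i hi; rw [Finset.mem_Icc] at hi; omega
  simp only [inspect, execList_cons, execList_nil, Instr.exec, Config.setInt, Config.setReal]
  repeat rw [Function.update_of_ne (h _ (by decide))]

/-- The results of an inspection of the cell with record `c`: polarized measurements minus what has
been recovered, and the data of the test. -/
theorem inspect_spec {s : Config} {c : ℕ} (h3 : s.ints 3 = 0) (h11 : s.ints 11 = 1)
    (h8 : s.ints 8 = c) (hc : 32 ≤ c) (hW : c + 4 < W) :
    let s' := execList W Φ y inspect s
    let u := coordAt y 0
    s'.reals 2 = u ∧
    s'.reals 4 = coordAt y (c + 1) ^ 2 - (coordAt y c ^ 2 + u ^ 2) - s.reals c ∧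
    s'.reals 5 = coordAt y (c + 2) ^ 2 - (coordAt y c ^ 2 + u ^ 2) - s.reals (c + 1) ∧
    s'.reals 7 = coordAt y (c + 4) ^ 2 - (coordAt y (c + 3) ^ 2 + u ^ 2) - s.reals (c + 2) ∧
    s'.ints 10 = (if ⌊s'.reals 7 / s'.reals 4⌋₊ < W then ⌊s'.reals 7 / s'.reals 4⌋₊ else 0) ∧
    s'.reals 15 = ((entryAt Φ 1 (s'.ints 10)).re - s'.reals 7 / s'.reals 4) ^ 2 := by
  have e1 : (c + 1) % W = c + 1 := Nat.mod_eq_of_lt (by omega)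
  have e2 : (c + 2) % W = c + 2 := Nat.mod_eq_of_lt (by omega)
  have e3 : (c + 3) % W = c + 3 := Nat.mod_eq_of_lt (by omega)
  have e4 : (c + 4) % W = c + 4 := Nat.mod_eq_of_lt (by omega)
  have hne : ∀ i ≤ 31, ∀ j, c + j ≠ i := by intros; omega
  have hne0 : ∀ i ≤ 31, c ≠ i := by intros; omega
  have hfl : ∀ a : ℕ, (if a < W then a else 0) % W = if a < W then a else 0 := by
    intro a; split_ifs with h
    · exact Nat.mod_eq_of_lt h
    · simp
  simp [inspect, Instr.exec, Config.setInt, Config.setReal, h3, h11, h8, e1, e2, e3, e4, hne,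
    hne0, hfl, add_assoc, sq]

theorem removeFromTable_ints (l : ℕ) (s : Config) {r : ℕ} (h7 : r ≠ 7) (h12 : r ≠ 12)
    (h14 : r ≠ 14) : (execList W Φ y (removeFromTable l) s).ints r = s.ints r := by
  simp [removeFromTable, Instr.exec, Config.setInt, Config.setReal, h7, h12, h14]

theorem removeFromTable_out (l : ℕ) (s : Config) :
    (execList W Φ y (removeFromTable l) s).out = s.out := rfl

theorem removeFromTables_ints (d : ℕ) (s : Config) {r : ℕ} (h7 : r ≠ 7) (h12 : r ≠ 12)
    (h14 : r ≠ 14) : (execList W Φ y (removeFromTables d) s).ints r = s.ints r := by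
  induction d with
  | zero => rfl
  | succ d ih => rw [removeFromTables, execList_append, removeFromTable_ints _ _ h7 h12 h14, ih]

theorem removeFromTables_out (d : ℕ) (s : Config) :
    (execList W Φ y (removeFromTables d) s).out = s.out := by
  induction d with
  | zero => rfl
  | succ d ih => rw [removeFromTables, execList_append, removeFromTable_out, ih]

theorem removeFromTable_spec {l : ℕ} {s : Config} {a b τ : ℕ} (h13 : s.ints 13 = b)
    (h11 : s.ints 11 = 1) (h4 : s.ints 4 = 5) (h7 : s.ints 7 = τ) (hb : 32 ≤ b)
    (hl : 2 + l < W) (hτ : b + a + 2 < τ) (hτW : τ + 5 < W)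
    (ha : (entryAt Φ (2 + l) (s.ints 10)).re = a) :
    let s' := execList W Φ y (removeFromTable l) s
    s'.ints 7 = τ + 5 ∧ s'.reals τ = a ∧
    s'.reals (b + a) = s.reals (b + a) + s.reals 4 ∧
    s'.reals (b + a + 1) = s.reals (b + a + 1) + s.reals 5 ∧
    s'.reals (b + a + 2) = s.reals (b + a + 2) + s.reals 7 ∧
    ∀ r, r ≠ 18 → r ≠ 19 → r ≠ τ → r ≠ b + a → r ≠ b + a + 1 → r ≠ b + a + 2 →
      s'.reals r = s.reals r := by
  have e0 : (b + a) % W = b + a := Nat.mod_eq_of_lt (by omega)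
  have e1 : (b + (a + 1)) % W = b + (a + 1) := Nat.mod_eq_of_lt (by omega)
  have e2 : (b + (a + 2)) % W = b + (a + 2) := Nat.mod_eq_of_lt (by omega)
  have el : (2 + l) % W = 2 + l := Nat.mod_eq_of_lt hl
  have eτ : (τ + 5) % W = τ + 5 := Nat.mod_eq_of_lt hτW
  have ea : a < W := by omega
  have n1 : ∀ i ≤ 31, ∀ j, b + j ≠ i := by intros; omega
  have n2 : ∀ i ≤ 31, τ ≠ i := by intros; omega
  have n3 : ∀ i ≤ 31, i ≠ τ := by intros; omega
  have n4 : ∀ i ≤ 31, ∀ j, i ≠ b + j := by intros; omega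
  have n5 : b + a ≠ τ := by omega
  have n6 : b + (a + 1) ≠ τ := by omega
  have n7 : b + (a + 2) ≠ τ := by omega
  simp +contextual [removeFromTable, Instr.exec, Config.setInt, Config.setReal, h13, h11, h4, h7,
    el, ha, eτ, ea, Nat.mod_eq_of_lt ea, add_assoc, e0, e1, e2, n1, n2, n3, n4, n5,
    n6, n7, n5.symm, n6.symm, n7.symm]

theorem emitCandidate_ints (s : Config) : (execList W Φ y emitCandidate s).ints = s.ints := rfl

theorem emitCandidate_reals (s : Config) {r : ℕ} (h2 : r ≠ 2) (h16 : r ≠ 16) (h17 : r ≠ 17) :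
    (execList W Φ y emitCandidate s).reals r = s.reals r := by
  simp [emitCandidate, Instr.exec, Config.setReal, Config.next, h2, h16, h17]

theorem emitCandidate_out (s : Config) : (execList W Φ y emitCandidate s).out =
    s.out ++ [(s.ints 10, ⟨s.reals 4 / (s.reals 2 + s.reals 2),
      s.reals 5 / (s.reals 2 + s.reals 2)⟩)] := by
  simp [emitCandidate, Instr.exec, Config.setReal, Config.next]

theorem pass_ints (d : ℕ) (s : Config) {r : ℕ}
    (hr : r ∈ ({0, 1, 2, 3, 4, 6, 11, 13} : Finset ℕ)) :
    (pass d W Φ y s).ints r = s.ints r := by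
  have h : ∀ r ∈ ({0, 1, 2, 3, 4, 6, 11, 13} : Finset ℕ), r ≠ 5 ∧ r ≠ 7 ∧ r ≠ 8 ∧ r ≠ 9 ∧
    r ≠ 10 ∧ r ≠ 12 ∧ r ≠ 14 := by decide
  obtain ⟨h5, h7, h8, h9, h10, h12, h14⟩ := h r hr
  simp only [pass]
  split_ifs
  · simp only [inspect_ints _ h5 h9 h10, fetched_ints _ h8]
  · simp only [execList_append, removeFromTables_ints _ _ h7 h12 h14, emitCandidate_ints,
      inspect_ints _ h5 h9 h10, fetched_ints _ h8]

theorem pass_ints_five (d : ℕ) (s : Config) :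
    (pass d W Φ y s).ints 5 = (s.ints 5 + s.ints 4) % W := by
  simp only [pass]
  split_ifs
  · simp [inspect_ints_five, fetched_ints]
  · simp [execList_append, removeFromTables_ints, emitCandidate_ints, inspect_ints_five,
      fetched_ints]

theorem pass_pc (d : ℕ) (s : Config) : (pass d W Φ y s).pc = 8 := by
  simp only [pass]
  split_ifs <;> rfl

end Effect

/-! ### Running time -/

section RunningTime

variable {m n d k : ℕ} {Φ : Matrix (Fin m) (Fin n) ℂ} {y : Fin m → ℝ}

/-- The integer cells at the head of the loop after `i` passes. -/
structure LoopHead (d m k i : ℕ) (s : Config) : Prop where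
  pc : s.pc = 8
  m_eq : s.ints 1 = m
  zero : s.ints 3 = 0
  five : s.ints 4 = 5
  counter : s.ints 5 = base d + 5 * i
  limit : s.ints 6 = base d + 45 * (d * k)
  one : s.ints 11 = 1
  base_eq : s.ints 13 = base d

theorem lt_wordBound (hm : m = base d + 40 * (d * k)) :
    base d + 45 * (d * k) + 10 + n < (peeler d).wordBound n m k := by
  simp only [Decoder.wordBound, peeler]
  have : 32 ≤ m := by rw [hm, base]; omega
  have : base d + 45 * (d * k) ≤ 2 * m := by omega
  nlinarith

theorem LoopHead.pass_succ {i : ℕ} {s : Config} (hm : m = base d + 40 * (d * k))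
    (hi : i < 9 * (d * k)) (hs : LoopHead d m k i s) :
    LoopHead d m k (i + 1) (pass d ((peeler d).wordBound n m k) Φ y s) := by
  have hW := lt_wordBound (n := n) hm
  constructor
  · exact pass_pc d s
  · rw [pass_ints d s (by decide), hs.m_eq]
  · rw [pass_ints d s (by decide), hs.zero]
  · rw [pass_ints d s (by decide), hs.five]
  · rw [pass_ints_five, hs.counter, hs.five, Nat.mod_eq_of_lt (by omega)]
    ring
  · rw [pass_ints d s (by decide), hs.limit]
  · rw [pass_ints d s (by decide), hs.one]
  · rw [pass_ints d s (by decide), hs.base_eq]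

theorem LoopHead.iterate_step {i : ℕ} {s : Config} (hi : i < 9 * (d * k))
    (hs : LoopHead d m k i s) :
    ∃ t ≤ 50 + 17 * d,
      ((peeler d).step k Φ y)^[t] s = pass d ((peeler d).wordBound n m k) Φ y s :=
  iterate_step_pass hs.pc (by rw [hs.counter, hs.limit]; omega)

theorem LoopHead.exists_halted {s : Config} (hs : LoopHead d m k (9 * (d * k)) s) :
    (peeler d).Halted (((peeler d).step k Φ y)^[2] s) ∧
      (((peeler d).step k Φ y)^[2] s).out = s.out := by
  have h0 : (peeler d).step k Φ y s = { s with pc := 9 } := by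
    rw [Decoder.step_of_getElem? (c := .jumpIlt 5 6 10) (by rw [hs.pc]; rfl)]
    simp only [Instr.exec]
    rw [if_neg (by rw [hs.counter, hs.limit]; omega)]
    simp [Config.next, hs.pc]
  rw [Function.iterate_succ_apply, h0, Function.iterate_one,
    Decoder.step_of_getElem? (c := .jump (100 + 100 * d)) rfl]
  refine ⟨?_, rfl⟩
  simp [Decoder.Halted, length_code_peeler, Instr.exec]
  omega

/-- The configuration in which the loop is entered: no cell has been inspected, and nothing has
been recovered. -/
structure LoopStart (d m k : ℕ) (s : Config) : Prop extends LoopHead d m k 0 s where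
  tail : s.ints 7 = m
  reals_eq : s.reals = fun _ => 0
  out_eq : s.out = []

theorem loopStart_run (hm : m = base d + 40 * (d * k)) :
    LoopStart d m k ((peeler d).run k Φ y 8) := by
  have hW := lt_wordBound (n := n) hm
  have h := Decoder.iterate_step_straight (P := peeler d) (k := k) (Φ := Φ) (y := y)
    (pre := []) (l := setup d) (post := fetch d ++ inspect ++ [.jumpRlt 0 15 8] ++
      (emitCandidate ++ removeFromTables d) ++ [.jump 8])
    (by simp [peeler]) (by simp [setup, Instr.Straight]) (s := (peeler d).init n m k) rfl
  have hrun : (peeler d).run k Φ y 8 =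
    execList ((peeler d).wordBound n m k) Φ y (setup d) ((peeler d).init n m k) := h
  set W := (peeler d).wordBound n m k with hW'
  have hkW : k < W := by
    rw [hW']; simp only [Decoder.wordBound, peeler]; nlinarith
  have hmW : m % W = m := Nat.mod_eq_of_lt (by omega)
  have h5 : 5 % W = 5 := Nat.mod_eq_of_lt (by omega)
  have h1 : 1 % W = 1 := Nat.mod_eq_of_lt (by omega)
  have hb : base d % W = base d := Nat.mod_eq_of_lt (by omega)
  have h5d : (5 * d) % W = 5 * d := Nat.mod_eq_of_lt (by
    rw [hW']; simp only [Decoder.wordBound, peeler]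
    have := Nat.pow_le_pow_left (show d + 32 ≤ n + m + k + 2 by rw [base] at hm; omega) 2
    nlinarith)
  have hmul : 5 * d * k = 5 * (d * k) := by ring
  have h5dk : (5 * (d * k)) % W = 5 * (d * k) := Nat.mod_eq_of_lt (by omega)
  have hlim : (m + 5 * (d * k)) % W = m + 5 * (d * k) := Nat.mod_eq_of_lt (by omega)
  have hlim' : m + 5 * (d * k) = base d + 45 * (d * k) := by omega
  rw [hrun]
  constructor
  · constructor
    · rw [execList_pc (by simp [setup, Instr.Straight])]; rfl
    all_goals
      simp [setup, Instr.exec, Config.setInt, Decoder.init, ← hW', hmW, h5, h1, hb, h5d, hmul,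
        h5dk, hlim, Nat.mod_eq_of_lt hkW]
    exact hlim'
  · simp [setup, Instr.exec, Config.setInt, Decoder.init, ← hW', hmW]
  · simp [setup, Instr.exec, Config.setInt, Decoder.init]
  · simp [setup, Instr.exec, Config.setInt, Decoder.init]

/-- A bound for the running time of the peeling decoder. -/
def timeBound (d k : ℕ) : ℕ := (50 + 17 * d) * (9 * (d * k)) + 10

/-- The decoder halts in time on every input, and what holds at the start of the loop and is
preserved by its passes holds for the final configuration. -/
theorem run_timeBound (hm : m = base d + 40 * (d * k)) (Inv : ℕ → Config → Prop)
    (h0 : ∀ s, LoopStart d m k s → Inv 0 s)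
    (hstep : ∀ i < 9 * (d * k), ∀ s, LoopHead d m k i s → Inv i s →
      Inv (i + 1) (pass d ((peeler d).wordBound n m k) Φ y s)) :
    (peeler d).Halted ((peeler d).run k Φ y (timeBound d k)) ∧
      ∃ s, LoopHead d m k (9 * (d * k)) s ∧ Inv (9 * (d * k)) s ∧
        ((peeler d).run k Φ y (timeBound d k)).out = s.out := by
  have hs := loopStart_run (Φ := Φ) (y := y) hm
  obtain ⟨t, ht, hL, hI⟩ := exists_iterate_of_invariant (f := (peeler d).step k Φ y)
    (N := 9 * (d * k)) (L := 50 + 17 * d) (fun i s => LoopHead d m k i s ∧ Inv i s)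
    (fun i hi s ⟨hL, hI⟩ => by
      obtain ⟨t, ht, h⟩ := hL.iterate_step (Φ := Φ) (y := y) hi
      exact ⟨t, ht, by rw [h]; exact ⟨hL.pass_succ hm hi, hstep i hi s hL hI⟩⟩)
    (s := (peeler d).run k Φ y 8) ⟨hs.toLoopHead, h0 _ hs⟩
  obtain ⟨hH, hout⟩ := hL.exists_halted (Φ := Φ) (y := y)
  set s := ((peeler d).step k Φ y)^[t] ((peeler d).run k Φ y 8)
  have hrun : (peeler d).run k Φ y (timeBound d k) = ((peeler d).step k Φ y)^[2] s := by
    have e : timeBound d k = (timeBound d k - (2 + t + 8)) + (2 + (t + 8)) := by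
      simp only [timeBound]; omega
    rw [Decoder.run, e, Function.iterate_add_apply, Function.iterate_add_apply _ 2,
      Function.iterate_add_apply _ t]
    exact Decoder.iterate_step_of_halted hH _
  rw [hrun]
  exact ⟨hH, s, hL, hI, hout⟩

end RunningTime

/-! ### Peeling -/

open scoped Classical in
/-- The members of `U` that the first `d` hash functions `C 0`, ..., `C (d - 1)` send to the
cell `q`. -/
noncomputable def bucket {n : ℕ} (C : ℕ → Fin n → ℕ) (d : ℕ) (U : Finset (Fin n)) (q : ℕ) :
    Finset (Fin n) :=
  U.filter fun j => ∃ l < d, C l j = q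

theorem mem_bucket {n : ℕ} {C : ℕ → Fin n → ℕ} {d : ℕ} {U : Finset (Fin n)} {q : ℕ} {j : Fin n} :
    j ∈ bucket C d U q ↔ j ∈ U ∧ ∃ l < d, C l j = q := by
  simp [bucket]

section Removal

variable {m n : ℕ} {W : ℕ} {Φ : Matrix (Fin m) (Fin n) ℂ} {y : Fin m → ℝ}

open scoped Classical in
/-- The effect of removing a coordinate with cells `c l` from all tables: the queue, which has its
end in record `T`, grows by the `d` cells, and the sums recovered from these cells are updated. -/
theorem removeFromTables_spec {d M T b : ℕ} {c : ℕ → ℕ} {s : Config} (h13 : s.ints 13 = b)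
    (h11 : s.ints 11 = 1) (h4 : s.ints 4 = 5) (h7 : s.ints 7 = b + 5 * T) (hb : 32 ≤ b)
    (hdb : 2 + d ≤ b) (hT : M ≤ T) (hW : b + 5 * (T + d) < W) (hc : ∀ l < d, c l < M)
    (hinj : ∀ l < d, ∀ l' < d, c l = c l' → l = l')
    (hΦ : ∀ l < d, (entryAt Φ (2 + l) (s.ints 10)).re = (5 * c l : ℕ)) :
    let s' := execList W Φ y (removeFromTables d) s
    s'.ints 7 = b + 5 * (T + d) ∧
    (∀ l < d, s'.reals (b + 5 * (T + l)) = (5 * c l : ℕ)) ∧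
    (∀ p, M ≤ p → (∀ l < d, p ≠ T + l) → s'.reals (b + 5 * p) = s.reals (b + 5 * p)) ∧
    (∀ r < 18, s'.reals r = s.reals r) ∧
    ∀ q < M,
      s'.reals (b + 5 * q) = s.reals (b + 5 * q) +
        (if ∃ l < d, c l = q then s.reals 4 else 0) ∧
      s'.reals (b + 5 * q + 1) = s.reals (b + 5 * q + 1) +
        (if ∃ l < d, c l = q then s.reals 5 else 0) ∧
      s'.reals (b + 5 * q + 2) = s.reals (b + 5 * q + 2) +
        (if ∃ l < d, c l = q then s.reals 7 else 0) := by
  induction d with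
  | zero => simpa [removeFromTables] using h7
  | succ d ih =>
    obtain ⟨i1, i2, i3, i4, i5⟩ := ih (by omega) (by omega) (fun l hl => hc l (by omega))
      (fun l hl l' hl' => hinj l (by omega) l' (by omega)) (fun l hl => hΦ l (by omega))
    simp only [removeFromTables, execList_append]
    set s1 := execList W Φ y (removeFromTables d) s with hs1
    have hcd := hc d (by omega)
    have hnew : ¬ ∃ l < d, c l = c d := by
      rintro ⟨l, hl, h⟩
      have := hinj l (by omega) d (by omega) h
      omega
    obtain ⟨j1, j2, j3, j4, j5, j6⟩ := removeFromTable_spec (W := W) (Φ := Φ) (y := y) (l := d)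
      (s := s1) (a := 5 * c d) (b := b) (τ := b + 5 * (T + d))
      (by rw [hs1, removeFromTables_ints _ _ (by decide) (by decide) (by decide), h13])
      (by rw [hs1, removeFromTables_ints _ _ (by decide) (by decide) (by decide), h11])
      (by rw [hs1, removeFromTables_ints _ _ (by decide) (by decide) (by decide), h4])
      i1 hb (by omega) (by omega) (by omega)
      (by rw [hs1, removeFromTables_ints _ _ (by decide) (by decide) (by decide), hΦ d (by omega)])
    refine ⟨by rw [j1]; ring, ?_, ?_, ?_, ?_⟩
    · intro l hl
      rcases Nat.lt_succ_iff_lt_or_eq.1 hl with hl | rfl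
      · rw [j6 _ (by omega) (by omega) (by omega) (by omega) (by omega) (by omega), i2 l hl]
      · exact j2
    · intro p hp hpl
      have := hpl d (by omega)
      rw [j6 _ (by omega) (by omega) (by omega) (by omega) (by omega) (by omega),
        i3 p hp fun l hl => hpl l (by omega)]
    · intro r hr
      rw [j6 _ (by omega) (by omega) (by omega) (by omega) (by omega) (by omega), i4 r hr]
    · intro q hq
      obtain ⟨k1, k2, k3⟩ := i5 q hq
      by_cases hqd : c d = q
      · subst hqd
        rw [if_neg hnew, add_zero] at k1 k2 k3
        have hex : ∃ l < d + 1, c l = c d := ⟨d, by omega, rfl⟩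
        simp only [if_pos hex]
        rw [j3, j4, j5, k1, k2, k3, i4 4 (by omega), i4 5 (by omega), i4 7 (by omega)]
        exact ⟨rfl, rfl, rfl⟩
      · have hiff : (∃ l < d + 1, c l = q) ↔ ∃ l < d, c l = q := by
          constructor
          · rintro ⟨l, hl, h⟩
            rcases Nat.lt_succ_iff_lt_or_eq.1 hl with hl | rfl
            · exact ⟨l, hl, h⟩
            · exact absurd h hqd
          · rintro ⟨l, hl, h⟩
            exact ⟨l, by omega, h⟩
        simp only [hiff]
        rw [j6 _ (by omega) (by omega) (by omega) (by omega) (by omega) (by omega),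
          j6 _ (by omega) (by omega) (by omega) (by omega) (by omega) (by omega),
          j6 _ (by omega) (by omega) (by omega) (by omega) (by omega) (by omega)]
        exact ⟨k1, k2, k3⟩

end Removal

/-- What the decoder has to find in the matrix `Φ` and the measurements `y` to recover the
vector `Z` up to a factor: the weights `g`, the cells `C`, and, coded by absolute values, the
sums of `Z` and the weighted sums of its real part over each cell. -/
structure Encodes {m n : ℕ} (d k : ℕ) (C : ℕ → Fin n → ℕ) (g : Fin n → ℝ) (Z : Fin n → ℂ)
    (Φ : Matrix (Fin m) (Fin n) ℂ) (y : Fin m → ℝ) : Prop where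
  weight : ∀ j : Fin n, (entryAt Φ 1 j).re = g j
  cell : ∀ l < d, ∀ j : Fin n, (entryAt Φ (2 + l) j).re = (5 * C l j : ℕ)
  re_sum : ∀ q < 8 * (d * k), coordAt y (base d + 5 * q + 1) ^ 2 -
    (coordAt y (base d + 5 * q) ^ 2 + coordAt y 0 ^ 2) =
      ∑ j ∈ bucket C d Finset.univ q, (Z j).re
  im_sum : ∀ q < 8 * (d * k), coordAt y (base d + 5 * q + 2) ^ 2 -
    (coordAt y (base d + 5 * q) ^ 2 + coordAt y 0 ^ 2) =
      ∑ j ∈ bucket C d Finset.univ q, (Z j).im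
  weighted_sum : ∀ q < 8 * (d * k), coordAt y (base d + 5 * q + 4) ^ 2 -
    (coordAt y (base d + 5 * q + 3) ^ 2 + coordAt y 0 ^ 2) =
      ∑ j ∈ bucket C d Finset.univ q, g j * (Z j).re

/-- Weights `g` with `⌊g j⌋ = j` that tell a cell with one member of `S` from a cell with several:
if the weighted sum of `z` over `U ⊆ S` is `g j` times the sum, then `U` has no member other
than `j`. -/
structure Separates {n : ℕ} (g z : Fin n → ℝ) (S : Finset (Fin n)) : Prop where
  pos : ∀ j, 0 < g j
  floor : ∀ j, ⌊g j⌋₊ = (j : ℕ)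
  ne_zero : ∀ j ∈ S, z j ≠ 0
  subset_singleton : ∀ U ⊆ S, ∀ j, ∑ i ∈ U, g i * z i = g j * ∑ i ∈ U, z i → U ⊆ {j}

/-- The invariant of the loop: before pass `i`, the members of `S` outside `U` have been recovered,
`r` in number. The queue of cells (multiplied by the record length) is stored after the records
of the `8 * (d * k)` cells; its unwritten places read as cell `0`. -/
structure PeelState {m n : ℕ} (d k : ℕ) (C : ℕ → Fin n → ℕ) (g : Fin n → ℝ) (Z : Fin n → ℂ)
    (S : Finset (Fin n)) (y : Fin m → ℝ) (r : ℕ) (U : Finset (Fin n)) (i : ℕ) (s : Config) :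
    Prop where
  subset : U ⊆ S
  card : r + U.card = S.card
  tail : s.ints 7 = base d + 5 * (8 * (d * k) + d * r)
  zero : s.reals 0 = 0
  re : ∀ q < 8 * (d * k), s.reals (base d + 5 * q) = ∑ j ∈ bucket C d (S \ U) q, (Z j).re
  im : ∀ q < 8 * (d * k), s.reals (base d + 5 * q + 1) = ∑ j ∈ bucket C d (S \ U) q, (Z j).im
  weighted : ∀ q < 8 * (d * k),
    s.reals (base d + 5 * q + 2) = ∑ j ∈ bucket C d (S \ U) q, g j * (Z j).re
  queue : ∀ p, 8 * (d * k) ≤ p → ∃ q < 8 * (d * k), s.reals (base d + 5 * p) = (5 * q : ℕ)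
  pending : ∀ q < 8 * (d * k), (bucket C d U q).card = 1 → i ≤ q ∨ ∃ p, 8 * (d * k) ≤ p ∧
    p < 8 * (d * k) + d * r ∧ i ≤ p ∧ s.reals (base d + 5 * p) = (5 * q : ℕ)
  out : ∀ j, toVector n s.out j = if j ∈ S \ U then
    ⟨(Z j).re / (coordAt y 0 + coordAt y 0), (Z j).im / (coordAt y 0 + coordAt y 0)⟩ else 0

theorem toVector_append {n : ℕ} (l l' : List (ℕ × ℂ)) :
    toVector n (l ++ l') = toVector n l + toVector n l' := by
  ext j
  simp [toVector]

theorem bucket_subset {n : ℕ} (C : ℕ → Fin n → ℕ) (d : ℕ) (U : Finset (Fin n)) (q : ℕ) :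
    bucket C d U q ⊆ U := fun _ hj => (mem_bucket.1 hj).1

theorem sum_bucket_sub {n d : ℕ} {C : ℕ → Fin n → ℕ} {S U : Finset (Fin n)} (hU : U ⊆ S)
    {f : Fin n → ℝ} (hf : ∀ j ∉ S, f j = 0) (q : ℕ) :
    ∑ j ∈ bucket C d Finset.univ q, f j - ∑ j ∈ bucket C d (S \ U) q, f j =
      ∑ j ∈ bucket C d U q, f j := by
  classical
  have h1 : ∑ j ∈ bucket C d Finset.univ q, f j = ∑ j ∈ bucket C d S q, f j := by
    symm
    apply Finset.sum_subset
    · intro j hj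
      simpa [mem_bucket] using (mem_bucket.1 hj).2
    · intro j hj hj'
      refine hf j fun hS => hj' ?_
      exact mem_bucket.2 ⟨hS, (mem_bucket.1 hj).2⟩
  have h2 : ∑ j ∈ bucket C d S q, f j =
      ∑ j ∈ bucket C d (S \ U) q, f j + ∑ j ∈ bucket C d U q, f j := by
    rw [← Finset.sum_union]
    · congr 1
      ext j
      simp only [mem_bucket, Finset.mem_union, Finset.mem_sdiff]
      constructor
      · rintro ⟨h, h'⟩
        by_cases hj : j ∈ U
        · exact Or.inr ⟨hj, h'⟩
        · exact Or.inl ⟨⟨h, hj⟩, h'⟩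
      · rintro (⟨⟨h, -⟩, h'⟩ | ⟨h, h'⟩)
        · exact ⟨h, h'⟩
        · exact ⟨hU h, h'⟩
    · rw [Finset.disjoint_left]
      intro j hj hj'
      exact (Finset.mem_sdiff.1 (mem_bucket.1 hj).1).2 (mem_bucket.1 hj').1
  rw [h1, h2]; ring

open scoped Classical in
theorem sum_bucket_sdiff_erase {n d : ℕ} {C : ℕ → Fin n → ℕ} {S U : Finset (Fin n)}
    {j : Fin n} (hjS : j ∈ S) (hj : j ∈ U) (f : Fin n → ℝ) (q : ℕ) :
    ∑ i ∈ bucket C d (S \ U.erase j) q, f i =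
      ∑ i ∈ bucket C d (S \ U) q, f i + if ∃ l < d, C l j = q then f j else 0 := by
  have hnot : j ∉ S \ U := by simp [hj]
  have : S \ U.erase j = insert j (S \ U) := by
    ext i
    simp only [Finset.mem_sdiff, Finset.mem_erase, Finset.mem_insert]
    by_cases h : i = j
    · simp [h, hjS]
    · simp [h]
  simp only [bucket, this, Finset.filter_insert]
  split_ifs
  · rw [Finset.sum_insert (by simp [hnot]), add_comm]
  · simp

section Peeling

variable {m n d k : ℕ} {C : ℕ → Fin n → ℕ} {g : Fin n → ℝ} {Z : Fin n → ℂ}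
  {S : Finset (Fin n)} {Φ : Matrix (Fin m) (Fin n) ℂ} {y : Fin m → ℝ} {r : ℕ}
  {U : Finset (Fin n)} {i : ℕ} {s : Config}

/-- Pass `i` inspects a cell `q`, and every other cell with exactly one member left is still pending
after it. -/
theorem PeelState.exists_fetched (hm : m = base d + 40 * (d * k)) (hL : LoopHead d m k i s)
    (hP : PeelState d k C g Z S y r U i s) :
    ∃ q < 8 * (d * k),
      (fetched ((peeler d).wordBound n m k) Φ y s).ints 8 = base d + 5 * q ∧
      ∀ q' < 8 * (d * k), (bucket C d U q').card = 1 → q' = q ∨ i + 1 ≤ q' ∨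
        ∃ p, 8 * (d * k) ≤ p ∧ p < 8 * (d * k) + d * r ∧ i + 1 ≤ p ∧
          s.reals (base d + 5 * p) = (5 * q' : ℕ) := by
  have hW := lt_wordBound (n := n) hm
  by_cases hi : i < 8 * (d * k)
  · refine ⟨i, hi, ?_, ?_⟩
    · rw [fetched_ints_eight_of_lt, hL.counter]
      · rw [hL.counter, hL.m_eq]; omega
      · exact hL.zero
      · rw [hL.counter]; omega
    · intro q' hq' h
      rcases hP.pending q' hq' h with h | ⟨p, hp, hp', hip, h⟩
      · by_cases e : q' = i
        · exact Or.inl e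
        · exact Or.inr (Or.inl (by omega))
      · exact Or.inr (Or.inr ⟨p, hp, hp', by omega, h⟩)
  · obtain ⟨q, hq, hqi⟩ := hP.queue i (by omega)
    refine ⟨q, hq, ?_, ?_⟩
    · rw [fetched_ints_eight_of_le (a := 5 * q), hL.base_eq]
      · rw [hL.counter, hL.m_eq]; omega
      · rw [hL.counter, hqi]
      · rw [hL.base_eq]; omega
    · intro q' hq' h
      rcases hP.pending q' hq' h with h | ⟨p, hp, hp', hip, h⟩
      · omega
      · by_cases e : p = i
        · subst e
          rw [hqi, Nat.cast_inj] at h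
          exact Or.inl (by omega)
        · exact Or.inr (Or.inr ⟨p, hp, hp', by omega, h⟩)

theorem PeelState.pass_succ (hn : 0 < n) (hm : m = base d + 40 * (d * k)) (hSk : S.card ≤ k)
    (hE : Encodes d k C g Z Φ y) (hZ : ∀ j ∉ S, Z j = 0)
    (hg : Separates g (fun j => (Z j).re) S)
    (hC : ∀ l < d, ∀ j, C l j < 8 * (d * k))
    (hinj : ∀ j, ∀ l < d, ∀ l' < d, C l j = C l' j → l = l')
    (hL : LoopHead d m k i s) (hP : PeelState d k C g Z S y r U i s) :
    ∃ r' U', PeelState d k C g Z S y r' U' (i + 1)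
      (pass d ((peeler d).wordBound n m k) Φ y s) := by
  classical
  have hW := lt_wordBound (n := n) hm
  obtain ⟨q, hq, hfetch, hpend⟩ := hP.exists_fetched (Φ := Φ) hm hL
  set W := (peeler d).wordBound n m k with hWdef
  have hb : 32 ≤ base d := by simp [base]
  obtain ⟨h2, h4, h5, h7, h10, h15⟩ := inspect_spec (Φ := Φ) (y := y)
    (s := fetched W Φ y s) (c := base d + 5 * q) (W := W)
    (by rw [fetched_ints _ (by decide), hL.zero]) (by rw [fetched_ints _ (by decide), hL.one])
    hfetch (by omega) (by omega)
  have hre : ∀ r, r = 0 ∨ 32 ≤ r →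
      (execList W Φ y inspect (fetched W Φ y s)).reals r = s.reals r := by
    intro r hr
    rw [inspect_reals _ (by omega), fetched_reals _ (by omega)]
  have hin : ∀ r, r ≠ 5 → r ≠ 8 → r ≠ 9 → r ≠ 10 →
      (execList W Φ y inspect (fetched W Φ y s)).ints r = s.ints r := by
    intro r h5 h8 h9 h10
    rw [inspect_ints _ h5 h9 h10, fetched_ints _ h8]
  have hout : (execList W Φ y inspect (fetched W Φ y s)).out = s.out := by
    rw [inspect_out, fetched_out]
  rw [fetched_reals _ (by omega), hE.re_sum q hq, hP.re q hq,
    sum_bucket_sub hP.subset (fun j hj => by simp [hZ j hj])] at h4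
  rw [fetched_reals _ (by omega), hE.im_sum q hq, hP.im q hq,
    sum_bucket_sub hP.subset (fun j hj => by simp [hZ j hj])] at h5
  rw [fetched_reals _ (by omega), hE.weighted_sum q hq, hP.weighted q hq,
    sum_bucket_sub hP.subset (fun j hj => by simp [hZ j hj])] at h7
  simp only [pass]
  set s' := execList W Φ y inspect (fetched W Φ y s)
  clear_value s'
  split_ifs with htest
  · -- A cell with a single member would have passed the test.
    have hnot : (bucket C d U q).card ≠ 1 := by
      intro h
      obtain ⟨j, hj⟩ := Finset.card_eq_one.1 h
      rw [hj, Finset.sum_singleton] at h4 h7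
      have hjS : j ∈ S := hP.subset (bucket_subset C d U q (hj ▸ Finset.mem_singleton_self j))
      have hratio : s'.reals 7 / s'.reals 4 = g j := by
        rw [h7, h4, mul_div_assoc, div_self (hg.ne_zero j hjS), mul_one]
      have hjn := j.2
      rw [hratio, hg.floor, if_pos (by omega)] at h10
      rw [h10, hE.weight, hratio, sub_self] at h15
      rw [h15, hre 0 (by omega), hP.zero] at htest
      norm_num at htest
    refine ⟨r, U, hP.subset, hP.card, ?_, ?_, ?_, ?_, ?_, ?_, ?_, ?_⟩
    · rw [← hP.tail]
      exact hin 7 (by decide) (by decide) (by decide) (by decide)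
    · rw [← hP.zero]; exact hre 0 (by omega)
    · intro q' hq'
      rw [← hP.re q' hq']; exact hre _ (by omega)
    · intro q' hq'
      rw [← hP.im q' hq']; exact hre _ (by omega)
    · intro q' hq'
      rw [← hP.weighted q' hq']; exact hre _ (by omega)
    · intro p hp
      obtain ⟨q', hq', h⟩ := hP.queue p hp
      exact ⟨q', hq', (hre _ (by omega)).trans h⟩
    · intro q' hq' h
      rcases hpend q' hq' h with h' | h' | ⟨p, hp, hp', hip, h'⟩
      · exact absurd (h' ▸ h) hnot
      · exact Or.inl h'
      · exact Or.inr ⟨p, hp, hp', hip, (hre _ (by omega)).trans h'⟩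
    · intro j
      rw [← hP.out j, ← hout]
  · -- The cell has a single member, the candidate.
    have heq : (entryAt Φ 1 (s'.ints 10)).re = s'.reals 7 / s'.reals 4 := by
      rw [hre 0 (by omega), hP.zero, h15] at htest
      have := le_antisymm (not_lt.1 htest) (sq_nonneg _)
      exact sub_eq_zero.1 (pow_eq_zero_iff two_ne_zero |>.1 this)
    have hjn : s'.ints 10 < n := by
      by_contra hcon
      have h0 : entryAt Φ 1 (s'.ints 10) = 0 := by
        simp only [entryAt]
        rw [dif_neg fun h => hcon h.2]
      rw [h0, Complex.zero_re] at heq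
      rw [← heq] at h10
      simp at h10
      omega
    obtain ⟨j, hj⟩ : ∃ j : Fin n, s'.ints 10 = j := ⟨⟨_, hjn⟩, rfl⟩
    rw [hj, hE.weight] at heq
    -- A cell with sum zero fails the test: its quotient is `0` by convention, and the weights
    -- are positive.
    have h4ne : s'.reals 4 ≠ 0 := by
      intro h0
      rw [h0, div_zero] at heq
      exact (hg.pos j).ne' heq
    have hsub : bucket C d U q ⊆ {j} := by
      refine hg.subset_singleton _ ((bucket_subset C d U q).trans hP.subset) j ?_
      rw [← h4, ← h7, heq, div_mul_cancel₀ _ h4ne]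
    have hbucket : bucket C d U q = {j} := by
      rcases Finset.subset_singleton_iff.1 hsub with h | h
      · rw [h, Finset.sum_empty] at h4
        exact absurd h4 h4ne
      · exact h
    have hjU : j ∈ U := bucket_subset C d U q (hbucket ▸ Finset.mem_singleton_self j)
    have hjS := hP.subset hjU
    rw [hbucket, Finset.sum_singleton] at h4 h5 h7
    -- Hence the inspected cell was pending, and the queue is not exhausted.
    have hidr : i < 8 * (d * k) + d * r := by
      rcases hP.pending q hq (by rw [hbucket, Finset.card_singleton]) with h | ⟨p, -, hp, hip, -⟩
      · omega
      · omega
    have hcardU : (U.erase j).card + 1 = U.card := Finset.card_erase_add_one hjU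
    have hcard := hP.card
    have hdr : d * r + d ≤ d * k := by
      rw [← Nat.mul_succ]
      exact Nat.mul_le_mul_left d (by omega)
    obtain ⟨k1, k2, k3, k4, k5⟩ := removeFromTables_spec (W := W) (Φ := Φ) (y := y) (d := d)
      (s := execList W Φ y emitCandidate s') (b := base d) (T := 8 * (d * k) + d * r)
      (M := 8 * (d * k)) (c := fun l => C l j)
      (by rw [emitCandidate_ints, hin _ (by decide) (by decide) (by decide) (by decide),
        hL.base_eq])
      (by rw [emitCandidate_ints, hin _ (by decide) (by decide) (by decide) (by decide), hL.one])
      (by rw [emitCandidate_ints, hin _ (by decide) (by decide) (by decide) (by decide), hL.five])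
      (by rw [emitCandidate_ints, hin _ (by decide) (by decide) (by decide) (by decide), hP.tail])
      hb (by simp [base]; omega) (by omega) (by omega) (fun l hl => hC l hl j) (hinj j)
      (fun l hl => by rw [emitCandidate_ints, hj, hE.cell l hl])
    rw [execList_append]
    have hout' : (execList W Φ y (removeFromTables d) (execList W Φ y emitCandidate s')).out =
        s.out ++ [((j : ℕ), ⟨(Z j).re / (coordAt y 0 + coordAt y 0),
          (Z j).im / (coordAt y 0 + coordAt y 0)⟩)] := by
      rw [removeFromTables_out, emitCandidate_out, hout, hj, h4, h5, h2]
    set s'' := execList W Φ y (removeFromTables d) (execList W Φ y emitCandidate s')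
    clear_value s''
    have hre2 : ∀ r, r = 0 ∨ 32 ≤ r → (execList W Φ y emitCandidate s').reals r = s.reals r := by
      intro r hr
      rw [emitCandidate_reals _ (by omega) (by omega) (by omega), hre r hr]
    refine ⟨r + 1, U.erase j, (Finset.erase_subset j U).trans hP.subset, by omega, ?_, ?_, ?_, ?_,
      ?_, ?_, ?_, ?_⟩
    · exact k1.trans (by ring)
    · exact (k4 0 (by omega)).trans ((hre2 0 (by omega)).trans hP.zero)
    · intro q' hq'
      rw [sum_bucket_sdiff_erase hjS hjU]
      refine (k5 q' hq').1.trans ?_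
      rw [hre2 _ (by omega), hP.re q' hq',
        emitCandidate_reals _ (by decide) (by decide) (by decide), h4]
    · intro q' hq'
      rw [sum_bucket_sdiff_erase hjS hjU]
      refine (k5 q' hq').2.1.trans ?_
      rw [hre2 _ (by omega), hP.im q' hq',
        emitCandidate_reals _ (by decide) (by decide) (by decide), h5]
    · intro q' hq'
      rw [sum_bucket_sdiff_erase hjS hjU]
      refine (k5 q' hq').2.2.trans ?_
      rw [hre2 _ (by omega), hP.weighted q' hq',
        emitCandidate_reals _ (by decide) (by decide) (by decide), h7]
    · intro p hp
      by_cases hpl : ∃ l < d, p = 8 * (d * k) + d * r + l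
      · obtain ⟨l, hl, rfl⟩ := hpl
        exact ⟨C l j, hC l hl j, k2 l hl⟩
      · push Not at hpl
        obtain ⟨q', hq', h⟩ := hP.queue p hp
        exact ⟨q', hq', (k3 p hp hpl).trans ((hre2 _ (by omega)).trans h)⟩
    · -- Only cells of the removed member can become singletons, and these have been queued.
      intro q' hq' h
      by_cases hjq : ∃ l < d, C l j = q'
      · obtain ⟨l, hl, rfl⟩ := hjq
        exact Or.inr ⟨8 * (d * k) + d * r + l, by omega, by rw [Nat.mul_succ]; omega, by omega,
          k2 l hl⟩
      · have hU' : bucket C d (U.erase j) q' = bucket C d U q' := by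
          ext i'
          simp only [mem_bucket, Finset.mem_erase]
          constructor
          · rintro ⟨⟨-, h⟩, h'⟩; exact ⟨h, h'⟩
          · rintro ⟨h, h'⟩
            refine ⟨⟨?_, h⟩, h'⟩
            rintro rfl
            exact hjq h'
        rw [hU'] at h
        rcases hpend q' hq' h with h' | h' | ⟨p, hp, hp', hip, h'⟩
        · exfalso
          subst h'
          have : j ∈ bucket C d U q' := hbucket ▸ Finset.mem_singleton_self j
          exact hjq (mem_bucket.1 this).2
        · exact Or.inl h'
        · refine Or.inr ⟨p, hp, by rw [Nat.mul_succ]; omega, hip, ?_⟩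
          exact (k3 p hp (by intro l hl; omega)).trans ((hre2 _ (by omega)).trans h')
    · intro j'
      simp only [hout', toVector_append, Pi.add_apply, hP.out j']
      by_cases e : j' = j
      · subst e
        simp [toVector, hjU, hjS]
      · have e' : (j : ℕ) ≠ j' := fun h => e (Fin.ext h.symm)
        simp [toVector, e, e']

end Peeling

section Peeling

variable {m n d k : ℕ} {C : ℕ → Fin n → ℕ} {g : Fin n → ℝ} {Z : Fin n → ℂ}
  {S : Finset (Fin n)} {Φ : Matrix (Fin m) (Fin n) ℂ} {y : Fin m → ℝ}

/-- If every non-empty subset of the support has a cell with exactly one of its members, then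
peeling does not get stuck, and the output is a positive multiple of `Z`. -/
theorem toVector_run_peeler (hn : 0 < n) (hm : m = base d + 40 * (d * k)) (hSk : S.card ≤ k)
    (hE : Encodes d k C g Z Φ y) (hZ : ∀ j ∉ S, Z j = 0)
    (hg : Separates g (fun j => (Z j).re) S)
    (hC : ∀ l < d, ∀ j, C l j < 8 * (d * k))
    (hinj : ∀ j, ∀ l < d, ∀ l' < d, C l j = C l' j → l = l')
    (hdk : 0 < d * k)
    (hpeel : ∀ U ⊆ S, U.Nonempty → ∃ q < 8 * (d * k), (bucket C d U q).card = 1) (j : Fin n) :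
    toVector n ((peeler d).run k Φ y (timeBound d k)).out j =
      ⟨(Z j).re / (coordAt y 0 + coordAt y 0), (Z j).im / (coordAt y 0 + coordAt y 0)⟩ := by
  obtain ⟨-, s, -, ⟨r, U, hP⟩, hout⟩ := run_timeBound (Φ := Φ) (y := y) hm
    (fun i s => ∃ r U, PeelState d k C g Z S y r U i s)
    (fun s hs => by
      have hb : ∀ q, bucket C d ∅ q = ∅ := by simp [bucket]
      refine ⟨0, S, Finset.Subset.refl S, by simp, ?_, ?_, ?_, ?_, ?_, ?_, ?_, ?_⟩
      · rw [hs.tail, hm]; ring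
      · simp [hs.reals_eq]
      · simp [hs.reals_eq, hb]
      · simp [hs.reals_eq, hb]
      · simp [hs.reals_eq, hb]
      · intro p _
        exact ⟨0, by omega, by simp [hs.reals_eq]⟩
      · exact fun q _ _ => Or.inl (Nat.zero_le q)
      · simp [hs.out_eq, toVector])
    (fun i _ s hL ⟨r, U, hP⟩ => hP.pass_succ hn hm hSk hE hZ hg hC hinj hL)
  rw [hout, hP.out j]
  have hU : U = ∅ := by
    by_contra hne
    obtain ⟨q, hq, hq1⟩ := hpeel U hP.subset (Finset.nonempty_iff_ne_empty.2 hne)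
    have hr : d * r ≤ d * k := Nat.mul_le_mul_left d (by have := hP.card; omega)
    rcases hP.pending q hq hq1 with h | ⟨p, -, hp, hip, -⟩
    · omega
    · omega
  by_cases hj : j ∈ S
  · simp [hU, hj]
  · simp [hj, hZ j hj]
    rfl

end Peeling

/-! ### The sensing matrix -/

/-- The number of the cell of coordinate `j` in table `l`; table `l` owns the `8 * k` cells from
`l * (8 * k)` on. Only the values for `l < d` matter. -/
def cell {d k n : ℕ} (h : Fin d → Fin n → Fin (8 * k)) (l : ℕ) (j : Fin n) : ℕ :=
  l * (8 * k) + if hl : l < d then (h ⟨l, hl⟩ j : ℕ) else 0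

theorem cell_of_lt {d k n : ℕ} (h : Fin d → Fin n → Fin (8 * k)) {l : ℕ} (hl : l < d)
    (j : Fin n) : cell h l j = l * (8 * k) + h ⟨l, hl⟩ j := by
  simp [cell, hl]

theorem cell_lt {d k n : ℕ} (h : Fin d → Fin n → Fin (8 * k)) {l : ℕ} (hl : l < d)
    (j : Fin n) : cell h l j < 8 * (d * k) := by
  rw [cell_of_lt h hl]
  have := (h ⟨l, hl⟩ j).2
  calc l * (8 * k) + (h ⟨l, hl⟩ j : ℕ) < (l + 1) * (8 * k) := by rw [Nat.succ_mul l]; omega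
    _ ≤ d * (8 * k) := Nat.mul_le_mul_right _ hl
    _ = 8 * (d * k) := by ring

theorem cell_eq_iff {d k n : ℕ} (h : Fin d → Fin n → Fin (8 * k)) {l l' : ℕ} (hl : l < d)
    (j : Fin n) (b : Fin (8 * k)) :
    cell h l j = l' * (8 * k) + b ↔ l = l' ∧ h ⟨l, hl⟩ j = b := by
  rw [cell_of_lt h hl]
  have h1 := (h ⟨l, hl⟩ j).2
  have h2 := b.2
  constructor
  · intro e
    have e1 : l = l' := by
      have := congrArg (· / (8 * k)) e
      simpa [Nat.mul_add_div (Nat.zero_lt_of_lt h2), mul_comm _ (8 * k), Nat.div_eq_of_lt h1,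
        Nat.div_eq_of_lt h2] using this
    subst e1
    exact ⟨rfl, Fin.ext (by omega)⟩
  · rintro ⟨rfl, e⟩
    rw [e]

theorem cell_injective {d k n : ℕ} (h : Fin d → Fin n → Fin (8 * k)) (j : Fin n) :
    ∀ l < d, ∀ l' < d, cell h l j = cell h l' j → l = l' := by
  intro l hl l' hl' e
  rw [cell_of_lt h hl'] at e
  exact ((cell_eq_iff h hl j _).1 e).1

/-- The weight of coordinate `j`; for `0 < t < 1` its integer part is `j`. -/
noncomputable def weight (t : ℝ) {n : ℕ} (j : Fin n) : ℝ := (j : ℕ) + t ^ ((j : ℕ) + 1)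

theorem weight_pos {t : ℝ} (ht : 0 < t) {n : ℕ} (j : Fin n) : 0 < weight t j := by
  unfold weight; positivity

theorem floor_weight {t : ℝ} (ht : 0 < t) (ht1 : t < 1) {n : ℕ} (j : Fin n) :
    ⌊weight t j⌋₊ = (j : ℕ) := by
  have h0 : 0 < t ^ ((j : ℕ) + 1) := by positivity
  have h1 : t ^ ((j : ℕ) + 1) < 1 := pow_lt_one₀ ht.le ht1 (by omega)
  rw [Nat.floor_eq_iff (weight_pos ht j).le]
  constructor <;> unfold weight <;> linarith

open scoped Classical in
/-- The rows of the sensing matrix. Row `0` measures the reference value `u`, the sum of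
`a ^ j * x j`. The other rows below `base d` only store the weights and the hash functions. The
five rows from `base d + 5 * q` on measure, for the sum `A` and the weighted sum `B` of the
coordinates in cell `q`, the values `A`, `A + u`, `A + I * u`, `B` and `B + u`. -/
noncomputable def sensingRow {d k n : ℕ} (h : Fin d → Fin n → Fin (8 * k)) (a t : ℝ) (i : ℕ)
    (j : Fin n) : ℂ :=
  if i < base d then
    if i = 0 then (a : ℂ) ^ (j : ℕ)
    else if i = 1 then (weight t j : ℂ)
    else if i < 2 + d then ((5 * cell h (i - 2) j : ℕ) : ℂ)
    else 0
  else
    let ind : ℂ := if ∃ l < d, cell h l j = (i - base d) / 5 then 1 else 0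
    if (i - base d) % 5 = 0 then ind
    else if (i - base d) % 5 = 1 then ind + (a : ℂ) ^ (j : ℕ)
    else if (i - base d) % 5 = 2 then ind + Complex.I * (a : ℂ) ^ (j : ℕ)
    else if (i - base d) % 5 = 3 then weight t j * ind
    else weight t j * ind + (a : ℂ) ^ (j : ℕ)

/-- The sensing matrix with hash functions `h`, reference parameter `a` and weight
parameter `t`. -/
noncomputable def sensingMatrix {d k n : ℕ} (m : ℕ) (h : Fin d → Fin n → Fin (8 * k)) (a t : ℝ) :
    Matrix (Fin m) (Fin n) ℂ :=
  fun i j => sensingRow h a t i j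

/-- The reference value of a signal. -/
noncomputable def reference (a : ℝ) {n : ℕ} (x : Fin n → ℂ) : ℂ :=
  ∑ j : Fin n, (a : ℂ) ^ (j : ℕ) * x j

theorem norm_add_sq_sub (v u : ℂ) :
    ‖v + u‖ ^ 2 - (‖v‖ ^ 2 + ‖u‖ ^ 2) = (2 * starRingEnd ℂ u * v).re := by
  simp only [← Complex.normSq_eq_norm_sq, Complex.normSq_apply]
  simp
  ring

theorem norm_add_I_mul_sq_sub (v u : ℂ) :
    ‖v + Complex.I * u‖ ^ 2 - (‖v‖ ^ 2 + ‖u‖ ^ 2) = (2 * starRingEnd ℂ u * v).im := by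
  simp only [← Complex.normSq_eq_norm_sq, Complex.normSq_apply]
  simp
  ring

section Sensing

variable {d k n m : ℕ} (h : Fin d → Fin n → Fin (8 * k)) (a t : ℝ) (x : Fin n → ℂ)

theorem coordAt_phaseless_sensingMatrix {i : ℕ} (hi : i < m) :
    coordAt (phaseless (sensingMatrix m h a t) x) i = ‖∑ j, sensingRow h a t i j * x j‖ := by
  simp [coordAt, hi, phaseless, Matrix.mulVec, dotProduct, sensingMatrix]

theorem entryAt_sensingMatrix {i : ℕ} (hi : i < m) (j : Fin n) :
    entryAt (sensingMatrix m h a t) i j = sensingRow h a t i j := by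
  simp [entryAt, hi, sensingMatrix]

open scoped Classical in
theorem sensingRow_record {q e : ℕ} (he : e < 5) (j : Fin n) :
    sensingRow h a t (base d + 5 * q + e) j =
      let ind : ℂ := if ∃ l < d, cell h l j = q then 1 else 0
      if e = 0 then ind
      else if e = 1 then ind + (a : ℂ) ^ (j : ℕ)
      else if e = 2 then ind + Complex.I * (a : ℂ) ^ (j : ℕ)
      else if e = 3 then weight t j * ind
      else weight t j * ind + (a : ℂ) ^ (j : ℕ) := by
  have h1 : ¬ base d + 5 * q + e < base d := by omega
  have h2 : (base d + 5 * q + e - base d) / 5 = q := by omega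
  have h3 : (base d + 5 * q + e - base d) % 5 = e := by omega
  rw [sensingRow, if_neg h1, h2, h3]

open scoped Classical in
theorem sum_indicator_mul (C : ℕ → Fin n → ℕ) (q : ℕ) (f : Fin n → ℂ) :
    ∑ j, (if ∃ l < d, C l j = q then (1 : ℂ) else 0) * f j =
      ∑ j ∈ bucket C d Finset.univ q, f j := by
  simp [bucket, Finset.sum_filter]

/-- By the polarization identity, the absolute values code the linear measurements of the
signal `2 * conj u * x`, where `u` is the reference value. -/
theorem encodes_sensingMatrix (hm : m = base d + 40 * (d * k)) :
    Encodes d k (cell h) (weight t) (fun j => 2 * starRingEnd ℂ (reference a x) * x j)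
      (sensingMatrix m h a t) (phaseless (sensingMatrix m h a t) x) := by
  have hb : base d = d + 32 := rfl
  have h0 : coordAt (phaseless (sensingMatrix m h a t) x) 0 = ‖reference a x‖ := by
    rw [coordAt_phaseless_sensingMatrix h a t x (by omega)]
    simp [sensingRow, base, reference]
  have hrec : ∀ q < 8 * (d * k), ∀ e < 5,
      coordAt (phaseless (sensingMatrix m h a t) x) (base d + 5 * q + e) =
        ‖∑ j, sensingRow h a t (base d + 5 * q + e) j * x j‖ := fun q hq e he =>
    coordAt_phaseless_sensingMatrix h a t x (by omega)
  have hA : ∀ q < 8 * (d * k), coordAt (phaseless (sensingMatrix m h a t) x) (base d + 5 * q) =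
      ‖∑ j ∈ bucket (cell h) d Finset.univ q, x j‖ := by
    intro q hq
    rw [← sum_indicator_mul]
    have h1 := hrec q hq 0 (by omega)
    rw [add_zero] at h1
    rw [h1]
    congr 1
    refine Finset.sum_congr rfl fun j _ => ?_
    have h2 := sensingRow_record h a t (q := q) (show 0 < 5 by omega) j
    rw [add_zero] at h2
    rw [h2]
    rfl
  have hB : ∀ q < 8 * (d * k), coordAt (phaseless (sensingMatrix m h a t) x)
      (base d + 5 * q + 3) = ‖∑ j ∈ bucket (cell h) d Finset.univ q, weight t j * x j‖ := by
    intro q hq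
    rw [← sum_indicator_mul, hrec q hq 3 (by omega)]
    congr 1
    refine Finset.sum_congr rfl fun j _ => ?_
    simp only [sensingRow_record h a t (show 3 < 5 by omega)]
    norm_num
  constructor
  · intro j
    rw [entryAt_sensingMatrix h a t (by omega)]
    simp [sensingRow, base]
  · intro l hl j
    rw [entryAt_sensingMatrix h a t (by omega)]
    have h1 : 2 + l < base d := by omega
    have h2 : 2 + l - 2 = l := by omega
    simp only [sensingRow, if_pos h1, h2, if_neg (show ¬ 2 + l = 0 by omega),
      if_neg (show ¬ 2 + l = 1 by omega), if_pos (show 2 + l < 2 + d by omega)]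
    exact Complex.natCast_re _
  · intro q hq
    rw [h0, hA q hq, hrec q hq 1 (by omega), ← Complex.re_sum, ← Finset.mul_sum,
      ← norm_add_sq_sub, reference, ← sum_indicator_mul, ← Finset.sum_add_distrib]
    simp only [sensingRow_record h a t (show 1 < 5 by omega)]
    simp [add_mul]
  · intro q hq
    rw [h0, hA q hq, hrec q hq 2 (by omega), ← Complex.im_sum, ← Finset.mul_sum,
      ← norm_add_I_mul_sq_sub, reference, ← sum_indicator_mul, Finset.mul_sum,
      ← Finset.sum_add_distrib]
    simp only [sensingRow_record h a t (show 2 < 5 by omega)]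
    simp [add_mul, mul_assoc]
  · intro q hq
    have hre : ∀ j, weight t j * (2 * starRingEnd ℂ (reference a x) * x j).re =
        (2 * starRingEnd ℂ (reference a x) * (weight t j * x j)).re := by
      intro j
      rw [← Complex.re_ofReal_mul]
      congr 1; ring
    simp only [hre]
    rw [h0, hB q hq, hrec q hq 4 (by omega), ← Complex.re_sum, ← Finset.mul_sum,
      ← norm_add_sq_sub, reference, ← sum_indicator_mul, ← Finset.sum_add_distrib]
    simp only [sensingRow_record h a t (show 4 < 5 by omega)]
    congr 3
    refine Finset.sum_congr rfl fun j _ => ?_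
    norm_num
    split_ifs <;> ring

end Sensing

theorem exists_exp_mul_I {w : ℂ} (hw : ‖w‖ = 1) :
    ∃ θ ∈ Set.Ico (0 : ℝ) (2 * Real.pi), Complex.exp (θ * Complex.I) = w := by
  have hpi : 0 < 2 * Real.pi := Real.two_pi_pos
  refine ⟨toIcoMod hpi 0 w.arg, by simpa using toIcoMod_mem_Ico hpi 0 w.arg, ?_⟩
  have hw' : Complex.exp (w.arg * Complex.I) = w := by
    simpa [hw] using Complex.norm_mul_exp_arg_mul_I w
  have e : ((w.arg - toIcoDiv hpi 0 w.arg • (2 * Real.pi) : ℝ) : ℂ) * Complex.I =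
      w.arg * Complex.I - toIcoDiv hpi 0 w.arg • (2 * Real.pi * Complex.I) := by
    push_cast [zsmul_eq_mul]
    ring
  rw [toIcoMod, e, Complex.exp_periodic.sub_zsmul_eq, hw']

/-- The decoder recovers the signal up to its phase if the weights separate and the hash
functions let the peeling go through. -/
theorem exists_phase_of_separates {d k n m : ℕ} {h : Fin d → Fin n → Fin (8 * k)} {a t : ℝ}
    {x : Fin n → ℂ} {S : Finset (Fin n)} (hn : 0 < n) (hm : m = base d + 40 * (d * k))
    (hdk : 0 < d * k)
    (hS : ∀ j, j ∈ S ↔ x j ≠ 0) (hSk : S.card ≤ k)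
    (hg : Separates (weight t) (fun j => (2 * starRingEnd ℂ (reference a x) * x j).re) S)
    (hpeel : ∀ U ⊆ S, U.Nonempty → ∃ q < 8 * (d * k), (bucket (cell h) d U q).card = 1) :
    ∃ θ ∈ Set.Ico (0 : ℝ) (2 * Real.pi),
      toVector n ((peeler d).run k (sensingMatrix m h a t)
        (phaseless (sensingMatrix m h a t) x) (timeBound d k)).out =
          Complex.exp (θ * Complex.I) • x := by
  have hrun := toVector_run_peeler hn hm hSk (encodes_sensingMatrix h a t x hm)
    (fun j hj => by
      have : x j = 0 := by by_contra h0; exact hj ((hS j).2 h0)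
      simp [this]) hg (fun l hl j => cell_lt h hl j) (cell_injective h) hdk hpeel
  have h0 : coordAt (phaseless (sensingMatrix m h a t) x) 0 = ‖reference a x‖ := by
    rw [coordAt_phaseless_sensingMatrix h a t x (by rw [hm, base]; omega)]
    simp [sensingRow, base, reference]
  rw [h0] at hrun
  -- For `x = 0` the reference value is zero; the quotients computed by the machine are then
  -- `0 / 0`, which is `0` in this model, as required.
  by_cases hx : S.Nonempty
  · obtain ⟨i, hi⟩ := hx
    have hu : reference a x ≠ 0 := by
      intro hu
      exact hg.ne_zero i hi (by simp [hu])
    have hu' : ‖reference a x‖ ≠ 0 := norm_ne_zero_iff.2 hu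
    obtain ⟨θ, hθ, hexp⟩ := exists_exp_mul_I (w := starRingEnd ℂ (reference a x) /
      ‖reference a x‖) (by simp [hu'])
    refine ⟨θ, hθ, ?_⟩
    ext j
    rw [hrun j, hexp, Pi.smul_apply, smul_eq_mul]
    have : starRingEnd ℂ (reference a x) / ‖reference a x‖ * x j =
        (2 * starRingEnd ℂ (reference a x) * x j) /
          ((‖reference a x‖ + ‖reference a x‖ : ℝ) : ℂ) := by
      have hu'' : (‖reference a x‖ : ℂ) ≠ 0 := by exact_mod_cast hu'
      push_cast
      field_simp
      ring
    rw [this]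
    apply Complex.ext
    · rw [Complex.div_ofReal_re]
    · rw [Complex.div_ofReal_im]
  · refine ⟨0, ⟨le_rfl, Real.two_pi_pos⟩, ?_⟩
    have hx0 : ∀ j, x j = 0 := by
      intro j
      by_contra hj
      exact hx ⟨j, (hS j).2 hj⟩
    ext j
    rw [hrun j]
    simp [hx0 j]
    rfl

/-! ### Stopping sets -/

/-- Choosing `s / 2` out of `b` values and then mapping `s` points to them: a bound for the
probability that a random map from `s` points to `b` values takes at most `s / 2` values, squared to
avoid fractional exponents. -/
theorem choose_mul_pow_le {b s : ℕ} (hb : 0 < b) (hs : s / 2 ≤ b) :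
    ((b.choose (s / 2) : ℝ) * ((s / 2 : ℕ) : ℝ) ^ s / (b : ℝ) ^ s) ^ 2 ≤
      (Real.exp 1 * s / (2 * b)) ^ s := by
  obtain ⟨q, hq⟩ : ∃ q, q = s / 2 := ⟨_, rfl⟩
  rw [← hq] at hs ⊢
  have hqs : 2 * q ≤ s := by omega
  have hb' : (0 : ℝ) < b := by exact_mod_cast hb
  have hqb : (q : ℝ) / b ≤ 1 := by
    rw [div_le_one hb']; exact_mod_cast hs
  have he : (1 : ℝ) ≤ Real.exp 1 := by simp
  have hfact : (q : ℝ) ^ q / q.factorial ≤ Real.exp 1 ^ q := by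
    rw [← Real.exp_nat_mul, mul_one]
    exact Real.pow_div_factorial_le_exp _ (Nat.cast_nonneg q) q
  have h1 : (b.choose q : ℝ) * (q : ℝ) ^ s / (b : ℝ) ^ s ≤
      Real.exp 1 ^ q * ((q : ℝ) / b) ^ (s - q) := by
    have hsq : s = q + (s - q) := by omega
    calc (b.choose q : ℝ) * (q : ℝ) ^ s / (b : ℝ) ^ s
        ≤ ((b : ℝ) ^ q / q.factorial) * (q : ℝ) ^ s / (b : ℝ) ^ s := by
          gcongr
          exact Nat.choose_le_pow_div q b
      _ = ((q : ℝ) ^ q / q.factorial) * ((q : ℝ) / b) ^ (s - q) := by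
          rw [div_pow]
          nth_rewrite 1 [hsq]
          nth_rewrite 2 [hsq]
          rw [pow_add, pow_add]
          have : (q.factorial : ℝ) ≠ 0 := by positivity
          field_simp
      _ ≤ _ := by gcongr
  calc ((b.choose q : ℝ) * (q : ℝ) ^ s / (b : ℝ) ^ s) ^ 2
      ≤ (Real.exp 1 ^ q * ((q : ℝ) / b) ^ (s - q)) ^ 2 := by gcongr
    _ = Real.exp 1 ^ (2 * q) * ((q : ℝ) / b) ^ (2 * (s - q)) := by
        rw [mul_pow, ← pow_mul, ← pow_mul, mul_comm q 2, mul_comm (s - q) 2]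
    _ ≤ Real.exp 1 ^ s * ((q : ℝ) / b) ^ s := by
        have h2 : Real.exp 1 ^ (2 * q) ≤ Real.exp 1 ^ s := pow_le_pow_right₀ he hqs
        have h3 : ((q : ℝ) / b) ^ (2 * (s - q)) ≤ ((q : ℝ) / b) ^ s :=
          pow_le_pow_of_le_one (by positivity) hqb (by omega)
        gcongr
    _ = (Real.exp 1 * q / b) ^ s := by rw [← mul_pow, mul_div_assoc]
    _ ≤ _ := by
        have : (2 : ℝ) * q ≤ s := by exact_mod_cast hqs
        have e : Real.exp 1 * s / (2 * b) = Real.exp 1 * (s / 2) / b := by field_simp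
        rw [e]
        gcongr
        linarith

/-- A union bound over the sets of `|U| / 2` values that can contain the image of `U`. -/
theorem card_image_le_half {n b : ℕ} (hb : 0 < b) (U : Finset (Fin n)) (hU : U.card / 2 ≤ b) :
    ((Finset.univ.filter fun f : Fin n → Fin b => 2 * (U.image f).card ≤ U.card).card : ℝ) ≤
      (b.choose (U.card / 2) : ℝ) * ((U.card / 2 : ℕ) : ℝ) ^ U.card / (b : ℝ) ^ U.card *
        (b : ℝ) ^ n := by
  classical
  have hsub : (Finset.univ.filter fun f : Fin n → Fin b => 2 * (U.image f).card ≤ U.card) ⊆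
      (Finset.powersetCard (U.card / 2) (Finset.univ : Finset (Fin b))).biUnion fun T =>
        Fintype.piFinset fun i => if i ∈ U then T else Finset.univ := by
    intro f hf
    have hf' : 2 * (U.image f).card ≤ U.card := (Finset.mem_filter.1 hf).2
    obtain ⟨T, hT, -, hTc⟩ := Finset.exists_subsuperset_card_eq (s := U.image f)
      (t := Finset.univ) (n := U.card / 2) (Finset.subset_univ _) (by omega) (by simpa using hU)
    refine Finset.mem_biUnion.2 ⟨T, Finset.mem_powersetCard.2 ⟨Finset.subset_univ _, hTc⟩, ?_⟩
    rw [Fintype.mem_piFinset]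
    intro i
    split_ifs with hi
    · exact hT (Finset.mem_image_of_mem f hi)
    · exact Finset.mem_univ _
  have hcard : ∀ T ∈ Finset.powersetCard (U.card / 2) (Finset.univ : Finset (Fin b)),
      (Fintype.piFinset fun i => if i ∈ U then T else Finset.univ).card =
        (U.card / 2) ^ U.card * b ^ (n - U.card) := by
    intro T hT
    rw [Fintype.card_piFinset]
    have : ∀ i, (if i ∈ U then T else Finset.univ).card = if i ∈ U then U.card / 2 else b := by
      intro i
      split_ifs
      · exact (Finset.mem_powersetCard.1 hT).2
      · simp
    simp only [this]
    rw [Finset.prod_ite]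
    simp [Finset.filter_not, Finset.card_sdiff]
  have hle := (Finset.card_le_card hsub).trans Finset.card_biUnion_le
  rw [Finset.sum_congr rfl hcard, Finset.sum_const, Finset.card_powersetCard, Finset.card_univ,
    Fintype.card_fin, smul_eq_mul] at hle
  have hUn : U.card ≤ n := by simpa using Finset.card_le_univ U
  calc _ ≤ ((b.choose (U.card / 2) * ((U.card / 2) ^ U.card * b ^ (n - U.card)) : ℕ) : ℝ) := by
        exact_mod_cast hle
    _ = _ := by
        have hb' : (b : ℝ) ≠ 0 := by exact_mod_cast hb.ne'
        have hn : (b : ℝ) ^ n = (b : ℝ) ^ U.card * (b : ℝ) ^ (n - U.card) := by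
          rw [← pow_add]; congr 1; omega
        rw [hn]
        push_cast
        field_simp

/-- In a set without a cell with exactly one member, every cell that is used in a table is used
at least twice. -/
theorem two_mul_card_image_le {d k n : ℕ} {h : Fin d → Fin n → Fin (8 * k)} {U : Finset (Fin n)}
    (hU : ∀ q < 8 * (d * k), (bucket (cell h) d U q).card ≠ 1) (l : Fin d) :
    2 * (U.image (h l)).card ≤ U.card := by
  classical
  refine Finset.mul_card_image_le_card _ _ fun b hb => ?_
  obtain ⟨j, hj, hjb⟩ := Finset.mem_image.1 hb
  have he : bucket (cell h) d U (l * (8 * k) + b) = U.filter fun i => h l i = b := by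
    ext i
    rw [mem_bucket, Finset.mem_filter]
    refine and_congr_right fun _ => ⟨?_, fun hi => ⟨l, l.2, ?_⟩⟩
    · rintro ⟨l', hl', e⟩
      obtain ⟨e1, e2⟩ := (cell_eq_iff h hl' i b).1 e
      subst e1
      exact e2
    · exact (cell_eq_iff h l.2 i b).2 ⟨rfl, hi⟩
  have h1 := hU (l * (8 * k) + b) (by
    have := cell_lt h l.2 j
    rwa [(cell_eq_iff h l.2 j b).2 ⟨rfl, hjb⟩] at this)
  rw [he] at h1
  have h2 : 0 < (U.filter fun i => h l i = b).card :=
    Finset.card_pos.2 ⟨j, Finset.mem_filter.2 ⟨hj, hjb⟩⟩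
  omega

/-- The contribution of the sets of size `s` to the union bound over stopping sets. -/
theorem choose_mul_pow_pow_le {k s D : ℕ} (hs : 0 < s) (hsk : s ≤ k) :
    (k.choose s : ℝ) * ((Real.exp 1 * s / (2 * (8 * k : ℕ))) ^ s) ^ (D + 1) ≤
      (1 / 2) ^ s * (1 / (k : ℝ)) ^ D := by
  have hs' : (0 : ℝ) < s := by exact_mod_cast hs
  have hk' : (0 : ℝ) < k := by exact_mod_cast hs.trans_le hsk
  have hsk' : (s : ℝ) / k ≤ 1 := by rw [div_le_one hk']; exact_mod_cast hsk
  have he := Real.exp_one_lt_d9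
  have he0 := Real.exp_pos 1
  have hfact : (s : ℝ) ^ s / s.factorial ≤ Real.exp 1 ^ s := by
    rw [← Real.exp_nat_mul, mul_one]
    exact Real.pow_div_factorial_le_exp _ (Nat.cast_nonneg s) s
  have h1 : (k.choose s : ℝ) ≤ (Real.exp 1 * k / s) ^ s := by
    calc (k.choose s : ℝ) ≤ (k : ℝ) ^ s / s.factorial := Nat.choose_le_pow_div s k
      _ = ((s : ℝ) ^ s / s.factorial) * ((k : ℝ) / s) ^ s := by
          rw [div_pow]; field_simp
      _ ≤ Real.exp 1 ^ s * ((k : ℝ) / s) ^ s := by gcongr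
      _ = _ := by rw [← mul_pow, mul_div_assoc]
  have h2 : (Real.exp 1 * s / (2 * (8 * k : ℕ))) ^ s ≤ 1 / (k : ℝ) := by
    have ha : Real.exp 1 * s / (2 * (8 * k : ℕ)) ≤ (1 / 2) * (s / k) := by
      push_cast
      rw [div_mul_div_comm, div_le_div_iff₀ (by positivity) (by positivity)]
      have : 0 < (s : ℝ) * k := by positivity
      nlinarith
    have hb : (1 / 2 : ℝ) ^ s ≤ 1 / s := by
      rw [div_pow, one_pow]
      exact one_div_le_one_div_of_le hs' (by exact_mod_cast (Nat.lt_two_pow_self).le)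
    have hc : ((s : ℝ) / k) ^ s ≤ s / k := pow_le_of_le_one (by positivity) hsk' hs.ne'
    calc (Real.exp 1 * s / (2 * (8 * k : ℕ))) ^ s ≤ ((1 / 2) * (s / k)) ^ s := by gcongr
      _ = (1 / 2 : ℝ) ^ s * ((s : ℝ) / k) ^ s := mul_pow _ _ _
      _ ≤ 1 / s * (s / k) := by gcongr
      _ = 1 / k := by field_simp
  have h3 : (Real.exp 1 * k / s) ^ s * (Real.exp 1 * s / (2 * (8 * k : ℕ))) ^ s ≤ (1 / 2) ^ s := by
    rw [← mul_pow]
    have : Real.exp 1 * k / s * (Real.exp 1 * s / (2 * (8 * k : ℕ))) = Real.exp 1 ^ 2 / 16 := by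
      push_cast; field_simp; norm_num
    rw [this]
    exact pow_le_pow_left₀ (by positivity) (by nlinarith) s
  rw [pow_succ']
  calc _ ≤ (Real.exp 1 * k / s) ^ s * ((Real.exp 1 * s / (2 * (8 * k : ℕ))) ^ s *
        (1 / (k : ℝ)) ^ D) := by gcongr
    _ = ((Real.exp 1 * k / s) ^ s * (Real.exp 1 * s / (2 * (8 * k : ℕ))) ^ s) *
        (1 / (k : ℝ)) ^ D := by ring
    _ ≤ _ := by gcongr

open scoped Classical in
/-- Few choices of the hash functions admit a stopping set, that is, a non-empty set of
coordinates none of whose cells has exactly one member. -/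
theorem card_stuck_le {D k n : ℕ} (hk : 0 < k) (S : Finset (Fin n)) (hS : S.card ≤ k) :
    ((Finset.univ.filter fun h : Fin (2 * (D + 1)) → Fin n → Fin (8 * k) =>
      ∃ U ⊆ S, U.Nonempty ∧ ∀ q < 8 * (2 * (D + 1) * k),
        (bucket (cell h) (2 * (D + 1)) U q).card ≠ 1).card : ℝ) ≤
      (1 / (k : ℝ)) ^ D *
        Fintype.card (Fin (2 * (D + 1)) → Fin n → Fin (8 * k)) := by
  set d := 2 * (D + 1) with hd
  set b := 8 * k with hb
  have hb0 : 0 < b := by omega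
  have hb' : (0 : ℝ) < b := by exact_mod_cast hb0
  set A : Finset (Fin n) → Finset (Fin n → Fin b) := fun U =>
    Finset.univ.filter fun f => 2 * (U.image f).card ≤ U.card with hA
  have hsub : (Finset.univ.filter fun h : Fin d → Fin n → Fin b =>
      ∃ U ⊆ S, U.Nonempty ∧ ∀ q < 8 * (d * k), (bucket (cell h) d U q).card ≠ 1) ⊆
      (S.powerset.erase ∅).biUnion fun U => Fintype.piFinset fun _ : Fin d => A U := by
    intro h hh
    obtain ⟨U, hUS, hU0, hU⟩ := (Finset.mem_filter.1 hh).2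
    refine Finset.mem_biUnion.2 ⟨U, ?_, ?_⟩
    · simp [hUS, hU0.ne_empty]
    · rw [Fintype.mem_piFinset]
      intro l
      simpa [hA] using two_mul_card_image_le hU l
  set H : ℝ := ((b : ℝ) ^ n) ^ d with hH
  have hHc : (Fintype.card (Fin d → Fin n → Fin b) : ℝ) = H := by simp [hH]
  set F : ℕ → ℝ := fun s =>
    if s = 0 then 0 else ((Real.exp 1 * s / (2 * b)) ^ s) ^ (D + 1) with hF
  have hF0 : ∀ s, 0 ≤ F s := by
    intro s; simp only [hF]; split_ifs <;> positivity
  have hterm : ∀ U ∈ S.powerset.erase ∅,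
      ((Fintype.piFinset fun _ : Fin d => A U).card : ℝ) ≤ F U.card * H := by
    intro U hU
    rw [Finset.mem_erase, Finset.mem_powerset] at hU
    have hUk : U.card ≤ k := (Finset.card_le_card hU.2).trans hS
    have hU0 : U.card ≠ 0 := by simpa using hU.1
    rw [Fintype.card_piFinset_const]
    have h1 := card_image_le_half hb0 U (by omega)
    have h2 := choose_mul_pow_le (s := U.card) hb0 (by omega)
    simp only [hF, if_neg hU0]
    push_cast
    calc ((A U).card : ℝ) ^ d ≤ _ := pow_le_pow_left₀ (Nat.cast_nonneg _) h1 d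
      _ = (((b.choose (U.card / 2) : ℝ) * ((U.card / 2 : ℕ) : ℝ) ^ U.card /
            (b : ℝ) ^ U.card) ^ 2) ^ (D + 1) * H := by
          rw [mul_pow, hH]
          congr 1
          rw [← pow_mul, hd]
      _ ≤ _ := by gcongr
  have hsum : ∑ U ∈ S.powerset.erase ∅, F U.card ≤ (1 / (k : ℝ)) ^ D := by
    calc ∑ U ∈ S.powerset.erase ∅, F U.card ≤ ∑ U ∈ S.powerset, F U.card :=
          Finset.sum_le_sum_of_subset_of_nonneg (Finset.erase_subset _ _) fun _ _ _ => hF0 _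
      _ = ∑ s ∈ Finset.range (S.card + 1), S.card.choose s • F s :=
          Finset.sum_powerset_apply_card F
      _ = ∑ s ∈ Finset.range S.card, (S.card.choose (s + 1) : ℝ) * F (s + 1) := by
          rw [Finset.sum_range_succ']
          simp [hF]
      _ ≤ ∑ s ∈ Finset.range S.card, (1 / 2) ^ (s + 1) * (1 / (k : ℝ)) ^ D := by
          refine Finset.sum_le_sum fun s hs => ?_
          have hs' : s + 1 ≤ k := by have := Finset.mem_range.1 hs; omega
          refine le_trans ?_ (choose_mul_pow_pow_le (Nat.succ_pos s) hs')
          simp only [hF, if_neg (Nat.succ_ne_zero s)]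
          gcongr
      _ = (1 / 2 * ∑ s ∈ Finset.range S.card, (1 / 2 : ℝ) ^ s) * (1 / (k : ℝ)) ^ D := by
          rw [Finset.mul_sum, Finset.sum_mul]
          exact Finset.sum_congr rfl fun s _ => by rw [pow_succ']
      _ ≤ 1 * (1 / (k : ℝ)) ^ D := by
          gcongr
          linarith [sum_geometric_two_le S.card]
      _ = _ := one_mul _
  rw [hHc]
  calc _ ≤ (((S.powerset.erase ∅).biUnion fun U =>
        Fintype.piFinset fun _ : Fin d => A U).card : ℝ) := by
        exact_mod_cast Finset.card_le_card hsub
    _ ≤ ∑ U ∈ S.powerset.erase ∅, ((Fintype.piFinset fun _ : Fin d => A U).card : ℝ) := by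
        exact_mod_cast Finset.card_biUnion_le
    _ ≤ ∑ U ∈ S.powerset.erase ∅, F U.card * H := Finset.sum_le_sum hterm
    _ = (∑ U ∈ S.powerset.erase ∅, F U.card) * H := by rw [Finset.sum_mul]
    _ ≤ _ := by gcongr

/-! ### Generic reference values and weights -/

open scoped Classical in
/-- The equation says that `f i` is a root of a fixed non-zero polynomial of degree at most `n`. -/
theorem card_roots_le {n N : ℕ} {f : Fin N → ℝ} (hf : Function.Injective f) (c₀ : ℝ)
    (c : Fin n → ℝ) {j : Fin n} (hj : c j ≠ 0) :
    (Finset.univ.filter fun i => c₀ + ∑ l, c l * f i ^ ((l : ℕ) + 1) = 0).card ≤ n := by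
  open Polynomial in
  set p : ℝ[X] := Polynomial.C c₀ + ∑ l : Fin n, Polynomial.C (c l) * X ^ ((l : ℕ) + 1) with hp
  have hcoeff : p.coeff ((j : ℕ) + 1) = c j := by
    rw [hp, Polynomial.coeff_add, Polynomial.coeff_C_succ, zero_add, Polynomial.finsetSum_coeff]
    rw [Finset.sum_eq_single j]
    · simp
    · intro l _ hl
      have : ¬ (j : ℕ) = l := fun h => hl (Fin.ext h.symm)
      simp [Polynomial.coeff_X_pow, this]
    · simp
  have hp0 : p ≠ 0 := fun h => hj (by rw [← hcoeff, h, Polynomial.coeff_zero])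
  have hdeg : p.natDegree ≤ n := by
    refine (Polynomial.natDegree_add_le _ _).trans (max_le (by simp) ?_)
    refine Polynomial.natDegree_sum_le_of_forall_le _ _ fun l _ => ?_
    exact (Polynomial.natDegree_C_mul_X_pow_le _ _).trans l.2
  calc _ ≤ p.roots.toFinset.card := by
        refine Finset.card_le_card_of_injOn f ?_ hf.injOn
        intro i hi
        have hi' := (Finset.mem_filter.1 hi).2
        simp only [Finset.mem_coe, Multiset.mem_toFinset, Polynomial.mem_roots hp0,
          Polynomial.IsRoot]
        rw [← hi', hp]
        simp [Polynomial.eval_finsetSum]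
    _ ≤ Multiset.card p.roots := Multiset.toFinset_card_le _
    _ ≤ p.natDegree := Polynomial.card_roots' p
    _ ≤ n := hdeg

open scoped Classical in
/-- For all but few parameters, the signal `2 * conj u * x` has non-zero real part on the support of
`x`: as a polynomial in the parameter, the real part at `j` has the coefficient `2 * |x j| ^ 2`. -/
theorem card_reference_degenerate_le {n N : ℕ} {f : Fin N → ℝ} (hf : Function.Injective f)
    (x : Fin n → ℂ) :
    (Finset.univ.filter fun i => ∃ j, x j ≠ 0 ∧
      (2 * starRingEnd ℂ (reference (f i) x) * x j).re = 0).card ≤ n * n := by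
  have hsub : (Finset.univ.filter fun i => ∃ j, x j ≠ 0 ∧
      (2 * starRingEnd ℂ (reference (f i) x) * x j).re = 0) ⊆
      (Finset.univ.filter fun j : Fin n => x j ≠ 0).biUnion fun j =>
        Finset.univ.filter fun i => (0 : ℝ) +
          ∑ l, (2 * starRingEnd ℂ (x l) * x j).re * f i ^ ((l : ℕ) + 1) = 0 := by
    intro i hi
    obtain ⟨j, hj, h⟩ := (Finset.mem_filter.1 hi).2
    refine Finset.mem_biUnion.2 ⟨j, by simp [hj], Finset.mem_filter.2 ⟨Finset.mem_univ _, ?_⟩⟩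
    rw [zero_add, ← mul_zero (f i), ← h, reference, map_sum, Finset.mul_sum, Finset.sum_mul,
      Complex.re_sum, Finset.mul_sum]
    refine Finset.sum_congr rfl fun l _ => ?_
    rw [map_mul, map_pow, Complex.conj_ofReal]
    have : 2 * ((f i : ℂ) ^ (l : ℕ) * starRingEnd ℂ (x l)) * x j =
        ((f i ^ (l : ℕ) : ℝ) : ℂ) * (2 * starRingEnd ℂ (x l) * x j) := by
      push_cast; ring
    rw [this, Complex.re_ofReal_mul]
    ring
  refine (Finset.card_le_card hsub).trans (Finset.card_biUnion_le.trans ?_)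
  refine (Finset.sum_le_card_nsmul _ _ n fun j hj => ?_).trans ?_
  · have hj' : x j ≠ 0 := (Finset.mem_filter.1 hj).2
    refine card_roots_le hf 0 _ (j := j) ?_
    have : 2 * starRingEnd ℂ (x j) * x j = ((2 * Complex.normSq (x j) : ℝ) : ℂ) := by
      rw [mul_assoc, ← Complex.normSq_eq_conj_mul_self]; push_cast; rfl
    rw [this, Complex.ofReal_re]
    simpa using hj'
  · rw [smul_eq_mul]
    exact Nat.mul_le_mul_right n ((Finset.card_le_univ _).trans_eq (Fintype.card_fin n))

open scoped Classical in
/-- For all but few parameters, the weights separate: if `l ∈ U` differs from `j`, then the monomial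
of the weight of `l` has the coefficient `z l`. -/
theorem card_weight_degenerate_le {n N : ℕ} {f : Fin N → ℝ} (hf : Function.Injective f)
    {z : Fin n → ℝ} {S : Finset (Fin n)} (hz : ∀ j ∈ S, z j ≠ 0) :
    (Finset.univ.filter fun i => ∃ U ⊆ S, ∃ j,
      ∑ l ∈ U, weight (f i) l * z l = weight (f i) j * ∑ l ∈ U, z l ∧ ¬ U ⊆ {j}).card ≤
        2 ^ n * n * n := by
  set c₀ : Finset (Fin n) × Fin n → ℝ := fun p =>
    ∑ l ∈ p.1, (((l : ℕ) : ℝ) - (p.2 : ℕ)) * z l with hc₀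
  set c : Finset (Fin n) × Fin n → Fin n → ℝ := fun p l =>
    (if l ∈ p.1 then z l else 0) - if l = p.2 then ∑ l ∈ p.1, z l else 0 with hc
  have hsub : (Finset.univ.filter fun i => ∃ U ⊆ S, ∃ j,
      ∑ l ∈ U, weight (f i) l * z l = weight (f i) j * ∑ l ∈ U, z l ∧ ¬ U ⊆ {j}) ⊆
      (Finset.univ.filter fun p : Finset (Fin n) × Fin n => p.1 ⊆ S ∧ ¬ p.1 ⊆ {p.2}).biUnion
        fun p => Finset.univ.filter fun i => c₀ p + ∑ l, c p l * f i ^ ((l : ℕ) + 1) = 0 := by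
    intro i hi
    obtain ⟨U, hU, j, h, hUj⟩ := (Finset.mem_filter.1 hi).2
    refine Finset.mem_biUnion.2 ⟨(U, j), Finset.mem_filter.2 ⟨Finset.mem_univ _, hU, hUj⟩,
      Finset.mem_filter.2 ⟨Finset.mem_univ _, ?_⟩⟩
    rw [← sub_eq_zero] at h
    rw [← h]
    simp only [hc, hc₀, sub_mul, ite_mul, zero_mul, Finset.sum_sub_distrib, weight, add_mul,
      Finset.sum_add_distrib, Finset.sum_ite_eq', Finset.mem_univ, if_true, Finset.sum_ite_mem,
      Finset.univ_inter, ← Finset.mul_sum]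
    have : ∑ l ∈ U, z l * f i ^ ((l : ℕ) + 1) = ∑ l ∈ U, f i ^ ((l : ℕ) + 1) * z l :=
      Finset.sum_congr rfl fun l _ => mul_comm _ _
    rw [this]
    ring
  refine (Finset.card_le_card hsub).trans (Finset.card_biUnion_le.trans ?_)
  refine (Finset.sum_le_card_nsmul _ _ n fun p hp => ?_).trans ?_
  · obtain ⟨hpS, hp2⟩ := (Finset.mem_filter.1 hp).2
    obtain ⟨l, hl, hlj⟩ := Finset.not_subset.1 hp2
    rw [Finset.mem_singleton] at hlj
    refine card_roots_le hf _ _ (j := l) ?_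
    simpa [hc, hl, hlj] using hz l (hpS hl)
  · rw [smul_eq_mul]
    refine Nat.mul_le_mul_right n ((Finset.card_le_univ _).trans ?_)
    simp

/-! ### The failure probability -/

/-- The law of `F ω` for a uniformly random element `ω` of a finite type. -/
noncomputable def uniformLaw {Ω E : Type*} [Fintype Ω] [MeasurableSpace E] (F : Ω → E) :
    Measure E :=
  ∑ ω, (Fintype.card Ω : ENNReal)⁻¹ • Measure.dirac (F ω)

theorem isProbabilityMeasure_uniformLaw {Ω E : Type*} [Fintype Ω] [Nonempty Ω]
    [MeasurableSpace E] (F : Ω → E) : IsProbabilityMeasure (uniformLaw F) := by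
  constructor
  simp only [uniformLaw, Measure.finsetSum_apply, Measure.smul_apply, measure_univ, smul_eq_mul,
    mul_one, Finset.sum_const, Finset.card_univ, nsmul_eq_mul]
  exact ENNReal.mul_inv_cancel (by simp) (by simp)

open scoped Classical in
theorem uniformLaw_le {Ω E : Type*} [Fintype Ω] [Nonempty Ω] [MeasurableSpace E]
    [MeasurableSingletonClass E] (F : Ω → E) (A : Set E) {ε : ℝ}
    (h : ((Finset.univ.filter fun ω => F ω ∈ A).card : ℝ) ≤ ε * Fintype.card Ω) :
    uniformLaw F A ≤ ENNReal.ofReal ε := by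
  have hpos : (0 : ℝ) < Fintype.card Ω := by exact_mod_cast Fintype.card_pos
  have hval : uniformLaw F A =
      (Fintype.card Ω : ENNReal)⁻¹ * (Finset.univ.filter fun ω => F ω ∈ A).card := by
    simp only [uniformLaw, Measure.finsetSum_apply, Measure.smul_apply, smul_eq_mul,
      Measure.dirac_apply, Set.indicator_apply, Pi.one_apply]
    rw [← Finset.mul_sum, Finset.sum_boole]
  rw [hval, mul_comm, ← div_eq_mul_inv]
  refine ENNReal.div_le_of_le_mul ?_
  have h1 : (Fintype.card Ω : ENNReal) = ENNReal.ofReal (Fintype.card Ω : ℝ) := by simp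
  have h2 : ((Finset.univ.filter fun ω => F ω ∈ A).card : ENNReal) =
      ENNReal.ofReal ((Finset.univ.filter fun ω => F ω ∈ A).card : ℝ) := by simp
  rw [h1, h2, ← ENNReal.ofReal_mul' hpos.le]
  exact ENNReal.ofReal_le_ofReal h

instance {m n : ℕ} : MeasurableSingletonClass (Matrix (Fin m) (Fin n) ℂ) :=
  inferInstanceAs (MeasurableSingletonClass (Fin m → Fin n → ℂ))

/-- The sensing matrix for given hash functions and indices of the two parameters. -/
noncomputable def indexedMatrix (d k n N m : ℕ)
    (ω : (Fin d → Fin n → Fin (8 * k)) × Fin N × Fin N) : Matrix (Fin m) (Fin n) ℂ :=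
  sensingMatrix m ω.1 ((ω.2.1 : ℕ) : ℝ) (1 / (((ω.2.2 : ℕ) : ℝ) + 2))

/-- The matrices with which the peeling decoder does not recover `x` up to a phase. -/
def failureSet (d k : ℕ) {m n : ℕ} (x : Fin n → ℂ) : Set (Matrix (Fin m) (Fin n) ℂ) :=
  {Φ | ¬ ∃ θ ∈ Set.Ico (0 : ℝ) (2 * Real.pi),
    toVector n ((peeler d).run k Φ (phaseless Φ x) (timeBound d k)).out =
      Complex.exp (θ * Complex.I) • x}

open scoped Classical in
/-- Failure needs bad hash functions, a bad reference parameter, or a bad weight parameter for a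
good reference parameter. -/
theorem card_failure_le {D d k n N m : ℕ} (hd : d = 2 * (D + 1)) (hn : 0 < n) (hk : 0 < k)
    (hm : m = base d + 40 * (d * k)) {x : Fin n → ℂ} (hx : IsSparse k x) :
    ((Finset.univ.filter fun ω => indexedMatrix d k n N m ω ∈ failureSet d k x).card : ℝ) ≤
      ((1 / (k : ℝ)) ^ D * N + (n * n + 2 ^ n * n * n)) * N *
        Fintype.card (Fin d → Fin n → Fin (8 * k)) := by
  set S : Finset (Fin n) := Finset.univ.filter fun j => x j ≠ 0 with hS
  have hSk : S.card ≤ k := by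
    have h := hx
    rw [IsSparse, Set.ncard_eq_toFinset_card'] at h
    simpa [hS] using h
  have hSx : ∀ j, j ∈ S ↔ x j ≠ 0 := by simp [hS]
  set fa : Fin N → ℝ := fun i => ((i : ℕ) : ℝ) with hfa
  set ft : Fin N → ℝ := fun i => 1 / (((i : ℕ) : ℝ) + 2) with hft
  have hfa_inj : Function.Injective fa := by
    intro i j h
    simp only [hfa, Nat.cast_inj] at h
    exact Fin.ext h
  have hft_inj : Function.Injective ft := by
    intro i j h
    simp only [hft, one_div, inv_inj, add_left_inj, Nat.cast_inj] at h
    exact Fin.ext h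
  set z : Fin N → Fin n → ℝ := fun i j =>
    (2 * starRingEnd ℂ (reference (fa i) x) * x j).re with hz
  set B1 := Finset.univ.filter fun h : Fin d → Fin n → Fin (8 * k) =>
    ∃ U ⊆ S, U.Nonempty ∧ ∀ q < 8 * (d * k), (bucket (cell h) d U q).card ≠ 1 with hB1
  set B2 := Finset.univ.filter fun i : Fin N => ∃ j, x j ≠ 0 ∧ z i j = 0 with hB2
  set B3 := Finset.univ.filter fun p : Fin N × Fin N => (∀ j ∈ S, z p.1 j ≠ 0) ∧
    ∃ U ⊆ S, ∃ j, ∑ l ∈ U, weight (ft p.2) l * z p.1 l = weight (ft p.2) j * ∑ l ∈ U, z p.1 l ∧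
      ¬ U ⊆ {j} with hB3
  have hc1 : (B1.card : ℝ) ≤ (1 / (k : ℝ)) ^ D * Fintype.card (Fin d → Fin n → Fin (8 * k)) :=
    by subst hd; exact card_stuck_le hk S hSk
  have hc2 : B2.card ≤ n * n := card_reference_degenerate_le hfa_inj x
  have hc3 : B3.card ≤ 2 ^ n * n * n * N := by
    refine (Finset.card_le_mul_card_image (f := Prod.fst) B3 (2 ^ n * n * n) fun i hi => ?_).trans
      (Nat.mul_le_mul_left _ ((Finset.card_le_univ _).trans_eq (Fintype.card_fin N)))
    obtain ⟨p, hp, rfl⟩ := Finset.mem_image.1 hi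
    have hp1 := (Finset.mem_filter.1 hp).2.1
    refine le_trans ?_ (card_weight_degenerate_le hft_inj hp1)
    refine Finset.card_le_card_of_injOn Prod.snd ?_ ?_
    · intro p' hp'
      obtain ⟨hp', he⟩ := Finset.mem_filter.1 hp'
      have h2 := (Finset.mem_filter.1 hp').2.2
      rw [he] at h2
      exact Finset.mem_coe.2 (Finset.mem_filter.2 ⟨Finset.mem_univ _, h2⟩)
    · intro p' hp' p'' hp'' e
      have e' := (Finset.mem_filter.1 hp').2
      have e'' := (Finset.mem_filter.1 hp'').2
      exact Prod.ext (e'.trans e''.symm) e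
  have hsub : (Finset.univ.filter fun ω => indexedMatrix d k n N m ω ∈ failureSet d k x) ⊆
      B1 ×ˢ Finset.univ ∪ Finset.univ ×ˢ (B2 ×ˢ Finset.univ) ∪ Finset.univ ×ˢ B3 := by
    intro ω hω
    replace hω := (Finset.mem_filter.1 hω).2
    by_contra hcon
    simp only [Finset.mem_union, Finset.mem_product, Finset.mem_univ, and_true, true_and,
      not_or] at hcon
    obtain ⟨⟨h1, h2⟩, h3⟩ := hcon
    have hnz : ∀ j ∈ S, z ω.2.1 j ≠ 0 := by
      intro j hj h0
      exact h2 (Finset.mem_filter.2 ⟨Finset.mem_univ _, j, (hSx j).1 hj, h0⟩)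
    have ht0 : 0 < ft ω.2.2 := by simp only [hft]; positivity
    have ht1 : ft ω.2.2 < 1 := by
      simp only [hft]
      rw [div_lt_one (by positivity)]
      have : (0 : ℝ) ≤ ((ω.2.2 : ℕ) : ℝ) := Nat.cast_nonneg _
      linarith
    refine hω (exists_phase_of_separates (S := S) hn hm (Nat.mul_pos (by omega) hk) hSx hSk
      ⟨weight_pos ht0, floor_weight ht0 ht1, hnz, ?_⟩ ?_)
    · intro U hU j he
      by_contra hUj
      exact h3 (Finset.mem_filter.2 ⟨Finset.mem_univ _, hnz, U, hU, j, he, hUj⟩)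
    · intro U hU hU0
      by_contra hq
      push Not at hq
      exact h1 (Finset.mem_filter.2 ⟨Finset.mem_univ _, U, hU, hU0, hq⟩)
  set H := Fintype.card (Fin d → Fin n → Fin (8 * k)) with hH
  have hcard := (Finset.card_le_card hsub).trans ((Finset.card_union_le _ _).trans
    (Nat.add_le_add_right (Finset.card_union_le _ _) _))
  simp only [Finset.card_product, Finset.card_univ, Fintype.card_prod, Fintype.card_fin] at hcard
  have hcard' : (B1.card * (N * N) + H * (B2.card * N) + H * B3.card : ℝ) ≤
      ((1 / (k : ℝ)) ^ D * H) * (N * N) + H * ((n * n : ℕ) * N) +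
        H * (2 ^ n * n * n * N : ℕ) := by
    gcongr
  refine le_trans (by exact_mod_cast hcard) (hcard'.trans (le_of_eq ?_))
  push_cast
  ring

/-- The number of values of the parameters can be taken so large that `K` bad values have
probability at most half of the allowed failure probability. -/
theorem exists_index_bound {k : ℕ} (hk : 0 < k) (c K : ℝ) :
    ∃ N : ℕ, 0 < N ∧ K ≤ (k : ℝ) ^ (-c) / 2 * N := by
  have hpos : 0 < (k : ℝ) ^ (-c) / 2 := by
    have : (0 : ℝ) < k := by exact_mod_cast hk
    positivity
  obtain ⟨N, hN⟩ := exists_nat_ge (K / ((k : ℝ) ^ (-c) / 2))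
  refine ⟨N + 1, Nat.succ_pos N, ?_⟩
  rw [div_le_iff₀ hpos] at hN
  push_cast
  nlinarith

theorem one_div_pow_le_rpow_neg {k D : ℕ} {c : ℝ} (hk : 2 ≤ k) (hD : c + 1 ≤ D) :
    (1 / (k : ℝ)) ^ D ≤ (k : ℝ) ^ (-c) / 2 := by
  have hk2 : (2 : ℝ) ≤ k := by exact_mod_cast hk
  have hk0 : (0 : ℝ) < k := by linarith
  calc (1 / (k : ℝ)) ^ D = (k : ℝ) ^ (-(D : ℝ)) := by
        rw [Real.rpow_neg hk0.le, Real.rpow_natCast, one_div, inv_pow]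
    _ ≤ (k : ℝ) ^ (-c - 1) := Real.rpow_le_rpow_of_exponent_le (by linarith) (by linarith)
    _ = (k : ℝ) ^ (-c) / k := Real.rpow_sub_one hk0.ne' _
    _ ≤ _ := by gcongr

end PhaseRetrieval

theorem theorem1 (c : ℝ) (hc : 0 < c) :
    ∃ (C : ℝ) (P : PhaseRetrieval.Decoder), 0 < C ∧ ∀ n k : ℕ, 2 ≤ k →
      ∃ (m : ℕ) (μ : Measure (Matrix (Fin m) (Fin n) ℂ))
        (R : Matrix (Fin m) (Fin n) ℂ → (Fin m → ℝ) → (Fin n → ℂ)),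
        (m : ℝ) ≤ C * k ∧
        IsProbabilityMeasure μ ∧
        (∀ (Φ : Matrix (Fin m) (Fin n) ℂ) (y : Fin m → ℝ),
          P.OutputsWithin k Φ y (C * (k * Real.log k)) (R Φ y)) ∧
        ∀ x : Fin n → ℂ, PhaseRetrieval.IsSparse k x →
          μ {Φ | ¬ ∃ θ ∈ Set.Ico (0 : ℝ) (2 * Real.pi),
              R Φ (PhaseRetrieval.phaseless Φ x) = Complex.exp (θ * Complex.I) • x} ≤
            ENNReal.ofReal ((k : ℝ) ^ (-c)) := by
  open PhaseRetrieval in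
  obtain ⟨D, hD⟩ := exists_nat_ge (c + 1)
  obtain ⟨d, hd⟩ : ∃ d, d = 2 * (D + 1) := ⟨_, rfl⟩
  have hd0 : (0 : ℝ) ≤ d := Nat.cast_nonneg d
  refine ⟨2 * ((50 + 17 * d) * (9 * d) + 10) + (d + 32) + 40 * d, peeler d, by positivity, ?_⟩
  intro n k hk
  have hk2 : (2 : ℝ) ≤ k := by exact_mod_cast hk
  obtain ⟨N, hN, hNK⟩ := exists_index_bound (k := k) (by omega) c (n * n + 2 ^ n * n * n)
  have : Nonempty (Fin N) := ⟨⟨0, hN⟩⟩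
  have : Nonempty (Fin (8 * k)) := ⟨⟨0, by omega⟩⟩
  obtain ⟨m, hm⟩ : ∃ m, m = base d + 40 * (d * k) := ⟨_, rfl⟩
  refine ⟨m, uniformLaw (indexedMatrix d k n N m),
    fun Φ y => toVector n ((peeler d).run k Φ y (timeBound d k)).out, ?_,
    isProbabilityMeasure_uniformLaw _, ?_, ?_⟩
  · rw [hm, base]
    push_cast
    have : 0 ≤ (50 + 17 * (d : ℝ)) * (9 * d) := by positivity
    nlinarith
  · intro Φ y
    refine ⟨timeBound d k, ?_, ?_, rfl⟩
    · have hlog : (1 / 2 : ℝ) ≤ Real.log k :=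
        le_trans (by linarith [Real.log_two_gt_d9]) (Real.log_le_log (by norm_num) hk2)
      have h1 : (1 / 2 : ℝ) * k ≤ k * Real.log k := by nlinarith
      have h2 : (timeBound d k : ℝ) ≤ ((50 + 17 * d) * (9 * d) + 10) * k := by
        simp only [timeBound]
        push_cast
        nlinarith
      calc (timeBound d k : ℝ) ≤ ((50 + 17 * d) * (9 * d) + 10) * k := h2
        _ = 2 * ((50 + 17 * d) * (9 * d) + 10) * (1 / 2 * k) := by ring
        _ ≤ (2 * ((50 + 17 * d) * (9 * d) + 10) + (d + 32) + 40 * d) * (1 / 2 * k) := by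
            gcongr
            linarith
        _ ≤ _ := by gcongr
    · exact (run_timeBound hm (fun _ _ => True) (fun _ _ => trivial)
        (fun _ _ _ _ _ => trivial)).1
  · intro x hx
    classical
    rcases Nat.eq_zero_or_pos n with rfl | hn
    · have : failureSet d k (m := m) x = ∅ := by
        refine Set.eq_empty_of_forall_notMem fun Φ hΦ => hΦ ?_
        exact ⟨0, ⟨le_rfl, Real.two_pi_pos⟩, Subsingleton.elim _ _⟩
      change uniformLaw _ (failureSet d k x) ≤ _
      rw [this, measure_empty]
      exact zero_le
    refine uniformLaw_le (indexedMatrix d k n N m) (failureSet d k x)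
      ((card_failure_le hd hn (by omega) hm hx).trans ?_)
    have hD' := one_div_pow_le_rpow_neg hk hD
    rw [Fintype.card_prod, Fintype.card_prod, Fintype.card_fin]
    push_cast
    set H : ℝ := ((Fintype.card (Fin d → Fin n → Fin (8 * k)) : ℕ) : ℝ) with hH
    have hsum : (1 / (k : ℝ)) ^ D * N + (n * n + 2 ^ n * n * n) ≤ (k : ℝ) ^ (-c) * N := by
      have := mul_le_mul_of_nonneg_right hD' (Nat.cast_nonneg (α := ℝ) N)
      linarith
    calc ((1 / (k : ℝ)) ^ D * N + (n * n + 2 ^ n * n * n)) * N * H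
        ≤ (k : ℝ) ^ (-c) * N * N * H := by gcongr
      _ = _ := by ring
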